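/- Let $J_L\in C^2(\mathbb R^2)$ and $J_F\in C^3(\mathbb R^2)$ be real-valued and assume: - for each $x_1\in\mathbb R$ the equation $\partial_{x_2}J_F(x_1,x_2)=0$ has a unique root $x_2=h(x_1)$, and $h\in C^1(\mathbb R)$; - there is $m_2>0$ with $\partial^2_{x_2x_2}J_F(x_1,x_2)\ge m_2$ for all $(x_1,x_2)\in\mathbb R^2$; - with $\tilde J_L(x_1):=J_L(x_1,h(x_1))$, there are $x_1^*\in\mathbb R$ with $\tilde J_L'(x_1^*)=0$ and $m_1>0$ with $\tilde J_L''(x_1)\ge m_1$ for all $x_1\in\mathbb R$. Put $x^*=(x_1^*,h(x_1^*))$. Fix $\alpha_1,k_1,\alpha_2>0$ and consider, for $\omega_1,\omega_2,k_2>0$, with $\varepsilon:=1/(\alpha_2k_2)$, the two-level nested extremum-seeking system $$\dot x_1=\sqrt{\alpha_1\omega_1}\cos\big(\omega_1t+k_1J_L(x_1,x_2)\big),\qquad \dot x_2=\sqrt{\alpha_2\omega_2}\cos\big(\omega_2t+k_2J_F(x_1,x_2)\big).$$ Then there are positive thresholds $\omega_1^*(\upsilon)$, $\varepsilon^*(\upsilon,\omega_1)$,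 $\omega_2^*(\upsilon,\omega_1,\varepsilon)$ such that, for parameters with $\omega_1>\omega_1^*(\upsilon)$, $0<\varepsilon<\varepsilon^*(\upsilon,\omega_1)$ and $\omega_2>\omega_2^*(\upsilon,\omega_1,\varepsilon)$, the system is $\upsilon$-semi-globally practically uniformly asymptotically stable to $x^*$, that is: there are $\beta\in\mathcal{KL}$ and $\sigma\in\mathcal K_\infty$ such that for every compact $K\subset\mathbb R^2$ there is $\upsilon^*>0$ such that, for every $0<\upsilon<\upsilon^*$, all parameters as above, all $t_0\in\mathbb R$ and all $x_0\in K$, a solution with $x(t_0)=x_0$ exists on $[t_0,\infty)$, and every such solution satisfies $$\|x(t)-x^*\|\le\beta(\|x_0-x^*\|,t-t_0)+\sigma(\upsilon)\qquad\text{for all }t\ge t_0.$$ -/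

import Mathlib

/-- Class `𝒦`: continuous, strictly increasing on `[0, ∞)`, and zero at zero. -/
structure IsClassK (σ : ℝ → ℝ) : Prop where
  continuousOn : ContinuousOn σ (Set.Ici 0)
  strictMonoOn : StrictMonoOn σ (Set.Ici 0)
  map_zero : σ 0 = 0

/-- Class `𝒦_∞`: class `𝒦` and unbounded. -/
structure IsClassKInf (σ : ℝ → ℝ) : Prop extends IsClassK σ where
  tendsto_atTop : Filter.Tendsto σ Filter.atTop Filter.atTop

/-- Class `𝒦ℒ`: continuous on `[0, ∞) × [0, ∞)`, of class `𝒦` in the first argument, and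
decreasing to zero in the second argument. -/
structure IsClassKL (β : ℝ → ℝ → ℝ) : Prop where
  continuousOn : ContinuousOn (Function.uncurry β) (Set.Ici 0 ×ˢ Set.Ici 0)
  isClassK : ∀ s, 0 ≤ s → IsClassK fun r => β r s
  antitoneOn : ∀ r, 0 ≤ r → AntitoneOn (β r) (Set.Ici 0)
  tendsto_zero : ∀ r, 0 ≤ r → Filter.Tendsto (β r) Filter.atTop (nhds 0)

/-- Semi-global practical uniform asymptotic stability of the point `xs`, as `υ → 0⁺`, for the
systems `ẋ = f t x`, where `F υ` is the set of vector fields `f` that are admissible for `υ`.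
The functions `β` and `σ` are the same for all compact sets `K` of initial conditions, all `υ`, all
admissible `f` and all initial times; only `υs` depends on `K`. -/
def IsSPUAS {E : Type*} [NormedAddCommGroup E] [NormedSpace ℝ E]
    (F : ℝ → Set (ℝ → E → E)) (xs : E) : Prop :=
  ∃ (β : ℝ → ℝ → ℝ) (σ : ℝ → ℝ), IsClassKL β ∧ IsClassKInf σ ∧
    ∀ K : Set E, IsCompact K → ∃ υs : ℝ, 0 < υs ∧
      ∀ υ : ℝ, 0 < υ → υ < υs → ∀ f ∈ F υ, ∀ t₀ : ℝ, ∀ x₀ ∈ K,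
        (∃ x : ℝ → E, x t₀ = x₀ ∧ IsIntegralCurveOn x f (Set.Ici t₀)) ∧
        ∀ x : ℝ → E, x t₀ = x₀ → IsIntegralCurveOn x f (Set.Ici t₀) →
          ∀ t : ℝ, t₀ ≤ t → ‖x t - xs‖ ≤ β ‖x₀ - xs‖ (t - t₀) + σ υ

/-- The two-level nested extremum-seeking vector field
`(√(α₁ω₁) cos(ω₁ t + k₁ J_L(x₁, x₂)), √(α₂ω₂) cos(ω₂ t + k₂ J_F(x₁, x₂)))`. -/
noncomputable def nesField (JL JF : ℝ → ℝ → ℝ) (α₁ k₁ ω₁ α₂ k₂ ω₂ : ℝ)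
    (t : ℝ) (x : EuclideanSpace ℝ (Fin 2)) : EuclideanSpace ℝ (Fin 2) :=
  !₂[√(α₁ * ω₁) * Real.cos (ω₁ * t + k₁ * JL (x 0) (x 1)),
     √(α₂ * ω₂) * Real.cos (ω₂ * t + k₂ * JF (x 0) (x 1))]

/-!
The velocity `√(α ω) cos (ω t + k j)` of a seeking loop averages to the gradient flow `-(αk/2) g`,
`g` being the slope of the measured cost `j`: subtracting two oscillating corrections from the state
leaves exactly this flow plus a remainder of size `O(1/√ω)`. A curvature bound on the cost then
makes the state track the minimiser exponentially, up to an error governed by the remainder, the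
speed of the minimiser and the error of the velocity.

Both levels are instances of this one tracking estimate. The follower tracks `h (x 0)`, which the
leader's dither moves at speed `O(√ω₁)`, so that its error is `O(√ω₁ / k₂)` as `ω₂ → ∞`. The leader
descends `JL x₁ (h x₁)`, with a velocity error proportional to the follower's distance from its
response. The initial layer of that error, of the form `κ ν e ^ (-ν t)` with `κ` of order `1/k₂`, is
absorbed into the state, because it integrates to at most `κ`. All errors vanish in the iterated
limit `ω₂ → ∞`, `k₂ → ∞`, `ω₁ → ∞`, which is the order of dependence of the thresholds.

The derivatives of the costs need to be bounded only on a compact tube around the graph of `h`, and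
a continuity argument shows that the trajectory never leaves it.
-/

open Filter Set Topology

section Comparison

variable {t₀ T : ℝ}

theorem hasDerivAt_exp_neg_mul_sub (c t₀ t : ℝ) :
    HasDerivAt (fun t => Real.exp (-(c * (t - t₀)))) (-(c * Real.exp (-(c * (t - t₀))))) t := by
  have hlin : HasDerivAt (fun t => -(c * (t - t₀))) (-(c * 1)) t :=
    (((hasDerivAt_id t).sub_const t₀).const_mul c).neg
  exact hlin.exp.congr_deriv (by ring)

theorem exp_neg_mul_sub_le_one {c t : ℝ} (hc : 0 ≤ c) (ht : t₀ ≤ t) :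
    Real.exp (-(c * (t - t₀))) ≤ 1 :=
  Real.exp_le_one_iff.2 (neg_nonpos.2 (mul_nonneg hc (sub_nonneg.2 ht)))

theorem le_mul_exp_add_of_deriv_le {z z' : ℝ → ℝ} {μ ρ Z : ℝ} (hμ : 0 < μ) (hρ : 0 ≤ ρ)
    (hZ : 0 ≤ Z) (hz₀ : z t₀ ≤ Z)
    (hz : ∀ t ∈ Icc t₀ T, HasDerivWithinAt z (z' t) (Icc t₀ T) t)
    (hz' : ∀ t ∈ Icc t₀ T, 0 < z t → z' t ≤ ρ - μ * z t) {t : ℝ} (ht : t ∈ Icc t₀ T) :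
    z t ≤ Z * Real.exp (-(μ * (t - t₀))) + ρ / μ := by
  refine le_of_forall_pos_le_add fun ε hε => ?_
  have hbarrier : ∀ s, HasDerivAt (fun s => Z * Real.exp (-(μ * (s - t₀))) + ρ / μ + ε)
      (Z * -(μ * Real.exp (-(μ * (s - t₀))))) s := fun s =>
    (((hasDerivAt_exp_neg_mul_sub μ t₀ s).const_mul Z).add_const _).add_const _
  refine image_le_of_deriv_right_lt_deriv_boundary' (f' := z')
    (fun s hs => (hz s hs).continuousWithinAt)
    (fun s hs => (hz s (Ico_subset_Icc_self hs)).mono_of_mem_nhdsWithin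
      (Icc_mem_nhdsGE_of_mem hs)) ?_ (fun s _ => (hbarrier s).continuousAt.continuousWithinAt)
    (fun s _ => (hbarrier s).hasDerivWithinAt) ?_ ht
  · have : 0 ≤ ρ / μ := by positivity
    simp only [sub_self, mul_zero, neg_zero, Real.exp_zero, mul_one]
    linarith
  · intro s hs hzs
    have hpos : 0 < z s := hzs ▸ by positivity
    have hle := hz' s (Ico_subset_Icc_self hs) hpos
    rw [hzs, mul_add, mul_add, mul_div_cancel₀ ρ hμ.ne'] at hle
    linarith [mul_pos hμ hε]

theorem le_mul_exp_add_of_perturbed_relaxation {y F r u : ℝ → ℝ} {μ η ρ κ ν : ℝ} (hμ : 0 < μ)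
    (hρ : 0 ≤ ρ) (hκ : 0 ≤ κ) (hν : 0 ≤ ν)
    (hy : ∀ t ∈ Icc t₀ T, HasDerivWithinAt y (-F t + r t) (Icc t₀ T) t)
    (hη : ∀ t ∈ Icc t₀ T, |y t - u t| ≤ η)
    (hF : ∀ t ∈ Icc t₀ T, μ * u t ^ 2 ≤ u t * F t)
    (hr : ∀ t ∈ Icc t₀ T, r t ≤ ρ + κ * (ν * Real.exp (-(ν * (t - t₀))))) {t : ℝ}
    (ht : t ∈ Icc t₀ T) :
    u t ≤ |u t₀| * Real.exp (-(μ * (t - t₀))) + (ρ / μ + 2 * η + κ) := by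
  -- The derivative of `κ * exp (-ν (t - t₀))` cancels the decaying part of the perturbation `r`.
  set z : ℝ → ℝ := fun t => y t + κ * Real.exp (-(ν * (t - t₀))) - (η + κ)
  have hzu : ∀ s ∈ Icc t₀ T, z s ≤ u s := fun s hs => by
    linarith [(abs_le.1 (hη s hs)).2,
      mul_le_of_le_one_right hκ (exp_neg_mul_sub_le_one hν hs.1)]
  have hz : ∀ s ∈ Icc t₀ T, HasDerivWithinAt z
      (-F s + r s + κ * -(ν * Real.exp (-(ν * (s - t₀))))) (Icc t₀ T) s := fun s hs =>
    ((hy s hs).add ((hasDerivAt_exp_neg_mul_sub ν t₀ s).const_mul κ).hasDerivWithinAt).sub_const _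
  have hz' : ∀ s ∈ Icc t₀ T, 0 < z s →
      -F s + r s + κ * -(ν * Real.exp (-(ν * (s - t₀)))) ≤ ρ - μ * z s := fun s hs hzs => by
    have hu : 0 < u s := hzs.trans_le (hzu s hs)
    have hFs : μ * u s ≤ F s := le_of_mul_le_mul_left (by linarith [hF s hs]) hu
    linarith [hr s hs, mul_le_mul_of_nonneg_left (hzu s hs) hμ.le]
  have hz₀ : z t₀ ≤ |u t₀| := (hzu t₀ ⟨le_rfl, ht.1.trans ht.2⟩).trans (le_abs_self _)
  have hzt : z t ≤ |u t₀| * Real.exp (-(μ * (t - t₀))) + ρ / μ :=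
    le_mul_exp_add_of_deriv_le hμ hρ (abs_nonneg _) hz₀ hz hz' ht
  have hκexp : 0 ≤ κ * Real.exp (-(ν * (t - t₀))) := by positivity
  linarith [(abs_le.1 (hη t ht)).1]

theorem abs_le_mul_exp_add_of_perturbed_relaxation {y F r u : ℝ → ℝ} {μ η ρ κ ν : ℝ}
    (hμ : 0 < μ) (hρ : 0 ≤ ρ) (hκ : 0 ≤ κ) (hν : 0 ≤ ν)
    (hy : ∀ t ∈ Icc t₀ T, HasDerivWithinAt y (-F t + r t) (Icc t₀ T) t)
    (hη : ∀ t ∈ Icc t₀ T, |y t - u t| ≤ η)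
    (hF : ∀ t ∈ Icc t₀ T, μ * u t ^ 2 ≤ u t * F t)
    (hr : ∀ t ∈ Icc t₀ T, |r t| ≤ ρ + κ * (ν * Real.exp (-(ν * (t - t₀))))) {t : ℝ}
    (ht : t ∈ Icc t₀ T) :
    |u t| ≤ |u t₀| * Real.exp (-(μ * (t - t₀))) + (ρ / μ + 2 * η + κ) := by
  have hupper := le_mul_exp_add_of_perturbed_relaxation hμ hρ hκ hν hy hη hF
    (fun s hs => (le_abs_self _).trans (hr s hs)) ht
  have hlower := le_mul_exp_add_of_perturbed_relaxation (y := fun s => -y s)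
    (F := fun s => -F s) (r := fun s => -r s) (u := fun s => -u s) hμ hρ hκ hν
    (fun s hs => (hy s hs).neg.congr_deriv (neg_add _ _))
    (fun s hs => by rw [neg_sub_neg, abs_sub_comm]; exact hη s hs)
    (fun s hs => by rw [neg_sq, neg_mul_neg]; exact hF s hs)
    (fun s hs => (neg_le_abs _).trans (hr s hs)) ht
  rw [abs_neg] at hlower
  exact abs_le'.2 ⟨hupper, hlower⟩

theorem forall_le_of_forall_le_imp_lt {g : ℝ → ℝ} {B : ℝ} (hg : ContinuousOn g (Ici t₀))
    (h₀ : g t₀ ≤ B) (hstep : ∀ t, t₀ ≤ t → (∀ s ∈ Icc t₀ t, g s ≤ B) → g t < B) {t : ℝ}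
    (ht : t₀ ≤ t) : g t ≤ B := by
  have hsub : Icc t₀ t ⊆ {s | g s ≤ B} := by
    refine IsClosed.Icc_subset_of_forall_mem_nhdsGT_of_Icc_subset ?_ h₀ fun s hs hss => ?_
    · rw [inter_comm]
      exact (hg.mono Icc_subset_Ici_self).preimage_isClosed_of_isClosed isClosed_Icc isClosed_Iic
    · have hcont : ContinuousWithinAt g (Ioi s) s :=
        (hg s hs.1).mono fun r hr => hs.1.trans (le_of_lt hr)
      filter_upwards [hcont.eventually_lt_const (hstep s hs.1 hss)] with r hr using hr.le
  exact hsub ⟨ht, le_rfl⟩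

end Comparison

section Averaging

/-- A scalar extremum-seeking loop on the time set `s`: the state `x` has velocity `v`, which is the
dither `√(α ω) cos (ω t + k j)` up to an error `d`; the measured cost `j` has slope `g` in `x` and
is otherwise displaced at rate `p`; and `q` is the velocity of `g`. The constant `M` bounds the
derivatives of the cost, and `B` the speed of the other variables on which the cost depends. -/
structure IsSeekingLoop (α k ω M B : ℝ) (x j g v p q d : ℝ → ℝ) (s : Set ℝ) : Prop where
  hasDerivWithinAt_state : ∀ t ∈ s, HasDerivWithinAt x (v t) s t
  hasDerivWithinAt_cost : ∀ t ∈ s, HasDerivWithinAt j (g t * v t + p t) s t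
  hasDerivWithinAt_slope : ∀ t ∈ s, HasDerivWithinAt g (q t) s t
  velocity_eq : ∀ t ∈ s, v t = √(α * ω) * Real.cos (ω * t + k * j t) + d t
  abs_velocity_le : ∀ t ∈ s, |v t| ≤ √(α * ω)
  abs_slope_le : ∀ t ∈ s, |g t| ≤ M
  abs_displacement_le : ∀ t ∈ s, |p t| ≤ M * B
  abs_slope_velocity_le : ∀ t ∈ s, |q t| ≤ M * (B + √(α * ω))

/-- The near-identity change of state which removes the oscillating part of the velocity of a
seeking loop: its two corrections are antiderivatives of `√(α ω) cos θ` and of `(αk/2) g cos (2 θ)`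
along the phase `θ = ω t + k j`, to leading order in `ω`. -/
noncomputable def averagedState (α k ω : ℝ) (x j g : ℝ → ℝ) (t : ℝ) : ℝ :=
  x t - √(α * ω) / ω * Real.sin (ω * t + k * j t) +
    α * k / (4 * ω) * (Real.sin (2 * (ω * t + k * j t)) * g t)

/-- The part of the velocity of `averagedState` which differs from the averaged gradient flow
`-(αk/2) g`, at phase `θ`. -/
noncomputable def averagedRemainder (α k ω θ g v p q d : ℝ) : ℝ :=
  d - √(α * ω) / ω * k * (Real.cos θ * (g * d + p)) +
    α * k / (4 * ω) * (2 * k * (Real.cos (2 * θ) * (g * v + p)) * g + Real.sin (2 * θ) * q)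

/-- Bound for the distance between the state of a seeking loop and its averaged state. -/
noncomputable def avgShift (α k ω M : ℝ) : ℝ :=
  √(α * ω) / ω + α * k / (4 * ω) * M

/-- Bound for the averaged remainder of a seeking loop whose velocity is exactly its dither. -/
noncomputable def avgDrift (α k ω M B : ℝ) : ℝ :=
  √(α * ω) / ω * k * (M * B) +
    α * k / (4 * ω) * (2 * k * (M * √(α * ω) + M * B) * M + M * (B + √(α * ω)))

/-- Amplification, in the averaged remainder, of the error `d` of the velocity of a seeking loop. -/
noncomputable def avgGain (α k ω M : ℝ) : ℝ :=
  1 + √(α * ω) / ω * k * M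

/-- The ultimate tracking error of a seeking loop whose cost has curvature at least `m`, when its
target has speed at most `V` and its velocity error is at most `D + κ ν e ^ (-ν (t - t₀))`. -/
noncomputable def seekingError (α k ω m M B V D κ : ℝ) : ℝ :=
  (avgDrift α k ω M B + V + avgGain α k ω M * D) / (α * k / 2 * m) + 2 * avgShift α k ω M +
    avgGain α k ω M * κ

variable {α k ω m M B V D κ ν : ℝ}

theorem avgDrift_nonneg (hα : 0 ≤ α) (hk : 0 ≤ k) (hω : 0 ≤ ω) (hM : 0 ≤ M) (hB : 0 ≤ B) :
    0 ≤ avgDrift α k ω M B := by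
  unfold avgDrift
  positivity

theorem avgShift_nonneg (hα : 0 ≤ α) (hk : 0 ≤ k) (hω : 0 ≤ ω) (hM : 0 ≤ M) :
    0 ≤ avgShift α k ω M := by
  unfold avgShift
  positivity

theorem avgGain_nonneg (hk : 0 ≤ k) (hω : 0 ≤ ω) (hM : 0 ≤ M) : 0 ≤ avgGain α k ω M := by
  unfold avgGain
  positivity

theorem abs_averagedRemainder_le {θ g v p q d : ℝ} (hα : 0 ≤ α) (hk : 0 ≤ k) (hω : 0 ≤ ω)
    (hg : |g| ≤ M) (hv : |v| ≤ √(α * ω)) (hp : |p| ≤ M * B) (hq : |q| ≤ M * (B + √(α * ω))) :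
    |averagedRemainder α k ω θ g v p q d| ≤ avgDrift α k ω M B + avgGain α k ω M * |d| := by
  have hM : 0 ≤ M := (abs_nonneg g).trans hg
  have hMB : 0 ≤ M * B := (abs_nonneg p).trans hp
  have hslope : ∀ {w W : ℝ}, |w| ≤ W → |g * w + p| ≤ M * W + M * B := fun {w W} hw =>
    (abs_add_le _ _).trans (by rw [abs_mul]; gcongr)
  have hfirst : |√(α * ω) / ω * k * (Real.cos θ * (g * d + p))| ≤
      √(α * ω) / ω * k * (1 * (M * |d| + M * B)) := by
    rw [abs_mul, abs_of_nonneg (by positivity), abs_mul]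
    gcongr
    exacts [Real.abs_cos_le_one θ, hslope le_rfl]
  have hphase : |2 * k * (Real.cos (2 * θ) * (g * v + p)) * g| ≤
      2 * k * (1 * (M * √(α * ω) + M * B)) * M := by
    rw [abs_mul, abs_mul, abs_of_nonneg (by positivity : 0 ≤ 2 * k), abs_mul]
    gcongr
    exacts [Real.abs_cos_le_one _, hslope hv]
  have hslope' : |Real.sin (2 * θ) * q| ≤ 1 * (M * (B + √(α * ω))) := by
    rw [abs_mul]
    gcongr
    exact Real.abs_sin_le_one _
  have hsecond : |α * k / (4 * ω) *
      (2 * k * (Real.cos (2 * θ) * (g * v + p)) * g + Real.sin (2 * θ) * q)| ≤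
      α * k / (4 * ω) *
        (2 * k * (1 * (M * √(α * ω) + M * B)) * M + 1 * (M * (B + √(α * ω)))) := by
    rw [abs_mul, abs_of_nonneg (by positivity)]
    gcongr
    exact (abs_add_le _ _).trans (add_le_add hphase hslope')
  calc |averagedRemainder α k ω θ g v p q d|
      ≤ |d| + √(α * ω) / ω * k * (1 * (M * |d| + M * B)) + α * k / (4 * ω) *
          (2 * k * (1 * (M * √(α * ω) + M * B)) * M + 1 * (M * (B + √(α * ω)))) :=
        (abs_add_le _ _).trans (add_le_add ((abs_sub _ _).trans (by gcongr)) hsecond)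
    _ = avgDrift α k ω M B + avgGain α k ω M * |d| := by
        unfold avgDrift avgGain
        ring

namespace IsSeekingLoop

variable {x j g v p q d : ℝ → ℝ} {s : Set ℝ} {t t₀ T : ℝ}

theorem hasDerivWithinAt_averagedState (hL : IsSeekingLoop α k ω M B x j g v p q d s)
    (hα : 0 ≤ α) (hω : 0 < ω) (ht : t ∈ s) :
    HasDerivWithinAt (averagedState α k ω x j g)
      (-(α * k / 2 * g t) +
        averagedRemainder α k ω (ω * t + k * j t) (g t) (v t) (p t) (q t) (d t)) s t := by
  have hθ : HasDerivWithinAt (fun t => ω * t + k * j t) (ω * 1 + k * (g t * v t + p t)) s t :=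
    ((hasDerivWithinAt_id t s).const_mul ω).add ((hL.hasDerivWithinAt_cost t ht).const_mul k)
  refine (((hL.hasDerivWithinAt_state t ht).sub (hθ.sin.const_mul (√(α * ω) / ω))).add
    (((hθ.const_mul 2).sin.mul (hL.hasDerivWithinAt_slope t ht)).const_mul
      (α * k / (4 * ω)))).congr_deriv ?_
  have hsq : √(α * ω) / ω * √(α * ω) = α := by
    rw [div_mul_eq_mul_div, Real.mul_self_sqrt (by positivity), mul_div_cancel_right₀ _ hω.ne']
  have hamp : √(α * ω) / ω * ω = √(α * ω) := div_mul_cancel₀ _ hω.ne'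
  have hcorr : α * k / (4 * ω) * ω = α * k / 4 := by field_simp
  rw [averagedRemainder, hL.velocity_eq t ht, Real.cos_two_mul]
  linear_combination
    (-Real.cos (ω * t + k * j t)) * hamp
      + (2 * (2 * Real.cos (ω * t + k * j t) ^ 2 - 1) * g t) * hcorr
      - k * Real.cos (ω * t + k * j t) ^ 2 * g t * hsq

theorem abs_averagedState_sub_le (hL : IsSeekingLoop α k ω M B x j g v p q d s) (hα : 0 ≤ α)
    (hk : 0 ≤ k) (hω : 0 ≤ ω) (ht : t ∈ s) :
    |averagedState α k ω x j g t - x t| ≤ avgShift α k ω M := by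
  have hfirst : |√(α * ω) / ω * Real.sin (ω * t + k * j t)| ≤ √(α * ω) / ω * 1 := by
    rw [abs_mul, abs_of_nonneg (by positivity)]
    gcongr
    exact Real.abs_sin_le_one _
  have hsecond : |α * k / (4 * ω) * (Real.sin (2 * (ω * t + k * j t)) * g t)| ≤
      α * k / (4 * ω) * (1 * M) := by
    rw [abs_mul, abs_of_nonneg (by positivity), abs_mul]
    gcongr
    exacts [Real.abs_sin_le_one _, hL.abs_slope_le t ht]
  rw [averagedState, avgShift, sub_add, sub_sub_cancel_left, neg_sub]
  linarith [abs_sub (α * k / (4 * ω) * (Real.sin (2 * (ω * t + k * j t)) * g t))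
    (√(α * ω) / ω * Real.sin (ω * t + k * j t))]

theorem abs_state_sub_target_le (hL : IsSeekingLoop α k ω M B x j g v p q d (Icc t₀ T)) (hα : 0 < α)
    (hk : 0 < k) (hω : 0 < ω) (hm : 0 < m) (hB : 0 ≤ B) (hV : 0 ≤ V) (hD : 0 ≤ D) (hκ : 0 ≤ κ)
    (hν : 0 ≤ ν) {c w : ℝ → ℝ} (hc : ∀ t ∈ Icc t₀ T, HasDerivWithinAt c (w t) (Icc t₀ T) t)
    (hw : ∀ t ∈ Icc t₀ T, |w t| ≤ V)
    (hd : ∀ t ∈ Icc t₀ T, |d t| ≤ D + κ * (ν * Real.exp (-(ν * (t - t₀)))))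
    (hg : ∀ t ∈ Icc t₀ T, m * (x t - c t) ^ 2 ≤ (x t - c t) * g t) (ht : t ∈ Icc t₀ T) :
    |x t - c t| ≤ |x t₀ - c t₀| * Real.exp (-(α * k / 2 * m * (t - t₀))) +
      seekingError α k ω m M B V D κ := by
  have hM : 0 ≤ M := (abs_nonneg _).trans (hL.abs_slope_le t ht)
  have hdrift := avgDrift_nonneg hα.le hk.le hω.le hM hB
  have hgain : 0 ≤ avgGain α k ω M := avgGain_nonneg hk.le hω.le hM
  refine abs_le_mul_exp_add_of_perturbed_relaxation (u := fun t => x t - c t)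
    (y := fun t => averagedState α k ω x j g t - c t) (F := fun t => α * k / 2 * g t)
    (r := fun t => averagedRemainder α k ω (ω * t + k * j t) (g t) (v t) (p t) (q t) (d t) - w t)
    (ν := ν) (by positivity) (by positivity) (by positivity) hν
    (fun s hs => ((hL.hasDerivWithinAt_averagedState hα.le hω hs).sub (hc s hs)).congr_deriv
      (add_sub_assoc _ _ _))
    (fun s hs => ?_) (fun s hs => ?_) (fun s hs => ?_) ht
  · rw [sub_sub_sub_cancel_right]
    exact hL.abs_averagedState_sub_le hα.le hk.le hω.le hs
  · linarith [mul_le_mul_of_nonneg_left (hg s hs) (by positivity : 0 ≤ α * k / 2)]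
  · have hrem := abs_averagedRemainder_le (θ := ω * s + k * j s) (d := d s) hα.le hk.le hω.le
      (hL.abs_slope_le s hs) (hL.abs_velocity_le s hs) (hL.abs_displacement_le s hs)
      (hL.abs_slope_velocity_le s hs)
    linarith [abs_sub (averagedRemainder α k ω (ω * s + k * j s) (g s) (v s) (p s) (q s) (d s))
      (w s), hw s hs, mul_le_mul_of_nonneg_left (hd s hs) hgain]

end IsSeekingLoop

theorem seekingError_nonneg (hα : 0 ≤ α) (hk : 0 ≤ k) (hω : 0 ≤ ω) (hm : 0 ≤ m) (hM : 0 ≤ M)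
    (hB : 0 ≤ B) (hV : 0 ≤ V) (hD : 0 ≤ D) (hκ : 0 ≤ κ) : 0 ≤ seekingError α k ω m M B V D κ := by
  have hdrift := avgDrift_nonneg hα hk hω hM hB
  have hshift := avgShift_nonneg hα hk hω hM
  have hgain : 0 ≤ avgGain α k ω M := avgGain_nonneg hk hω hM
  unfold seekingError
  positivity

end Averaging

section Calculus

/-- The partial derivative of a function of two real variables in its first argument. -/
noncomputable def partialFst (J : ℝ → ℝ → ℝ) (x y : ℝ) : ℝ :=
  deriv (fun s => J s y) x

/-- The partial derivative of a function of two real variables in its second argument. -/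
noncomputable def partialSnd (J : ℝ → ℝ → ℝ) (x y : ℝ) : ℝ :=
  deriv (J x) y

variable {J : ℝ → ℝ → ℝ}

theorem partialFst_eq_fderiv (hJ : Differentiable ℝ (fun p : ℝ × ℝ => J p.1 p.2)) (p : ℝ × ℝ) :
    partialFst J p.1 p.2 = fderiv ℝ (fun p : ℝ × ℝ => J p.1 p.2) p (1, 0) :=
  ((hJ p).hasFDerivAt.comp_hasDerivAt (f := fun s => (s, p.2)) p.1
    ((hasDerivAt_id p.1).prodMk (hasDerivAt_const p.1 p.2))).deriv

theorem partialSnd_eq_fderiv (hJ : Differentiable ℝ (fun p : ℝ × ℝ => J p.1 p.2)) (p : ℝ × ℝ) :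
    partialSnd J p.1 p.2 = fderiv ℝ (fun p : ℝ × ℝ => J p.1 p.2) p (0, 1) :=
  ((hJ p).hasFDerivAt.comp_hasDerivAt (f := fun s => (p.1, s)) p.2
    ((hasDerivAt_const p.2 p.1).prodMk (hasDerivAt_id p.2))).deriv

theorem contDiff_partialFst {n : ℕ} (hJ : ContDiff ℝ (n + 1) (fun p : ℝ × ℝ => J p.1 p.2)) :
    ContDiff ℝ n (fun p : ℝ × ℝ => partialFst J p.1 p.2) := by
  simp only [partialFst_eq_fderiv (hJ.differentiable (by simp))]
  exact (hJ.fderiv_right le_rfl).clm_apply contDiff_const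

theorem contDiff_partialSnd {n : ℕ} (hJ : ContDiff ℝ (n + 1) (fun p : ℝ × ℝ => J p.1 p.2)) :
    ContDiff ℝ n (fun p : ℝ × ℝ => partialSnd J p.1 p.2) := by
  simp only [partialSnd_eq_fderiv (hJ.differentiable (by simp))]
  exact (hJ.fderiv_right le_rfl).clm_apply contDiff_const

theorem hasDerivWithinAt_comp_prodMk (hJ : Differentiable ℝ (fun p : ℝ × ℝ => J p.1 p.2))
    {x y : ℝ → ℝ} {x' y' t : ℝ} {s : Set ℝ} (hx : HasDerivWithinAt x x' s t)
    (hy : HasDerivWithinAt y y' s t) :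
    HasDerivWithinAt (fun t => J (x t) (y t))
      (partialFst J (x t) (y t) * x' + partialSnd J (x t) (y t) * y') s t := by
  refine ((hJ (x t, y t)).hasFDerivAt.comp_hasDerivWithinAt t (hx.prodMk hy)).congr_deriv ?_
  rw [partialFst_eq_fderiv hJ (x t, y t), partialSnd_eq_fderiv hJ (x t, y t), mul_comm _ x',
    mul_comm _ y', ← smul_eq_mul, ← smul_eq_mul, ← map_smul, ← map_smul, ← map_add]
  simp

theorem contDiff_succ_of_implicit {g : ℝ → ℝ → ℝ} {h : ℝ → ℝ} {n : ℕ}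
    (hg : ContDiff ℝ (n + 1) (fun p : ℝ × ℝ => g p.1 p.2)) (hh : Differentiable ℝ h)
    (hn : ContDiff ℝ n h) (hroot : ∀ x, g x (h x) = 0) (hslope : ∀ x, partialSnd g x (h x) ≠ 0) :
    ContDiff ℝ (n + 1) h := by
  have hderiv : deriv h = fun x => -partialFst g x (h x) / partialSnd g x (h x) := by
    funext x
    have hzero : partialFst g x (h x) * 1 + partialSnd g x (h x) * deriv h x = 0 := by
      have hchain := hasDerivWithinAt_comp_prodMk (hg.differentiable (by simp))
        (hasDerivWithinAt_id x univ) (hh x).hasDerivAt.hasDerivWithinAt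
      simp only [id, hroot, hasDerivWithinAt_univ] at hchain
      exact hchain.unique (hasDerivAt_const x 0)
    rw [eq_div_iff (hslope x)]
    linarith
  refine contDiff_succ_iff_deriv.2 ⟨hh, by simp, hderiv ▸ ?_⟩
  have hgraph : ContDiff ℝ n fun x => (x, h x) := contDiff_id.prodMk hn
  exact ((contDiff_partialFst hg).comp hgraph).neg.div ((contDiff_partialSnd hg).comp hgraph)
    hslope

theorem mul_sub_sq_le_of_le_deriv {f : ℝ → ℝ} {m c : ℝ} (hf : Differentiable ℝ f)
    (hm : ∀ x, m ≤ deriv f x) (hc : f c = 0) (x : ℝ) : m * (x - c) ^ 2 ≤ (x - c) * f x := by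
  rcases le_total c x with hcx | hxc
  · have hmean := mul_sub_le_image_sub_of_le_deriv hf hm hcx
    rw [hc] at hmean
    linarith [mul_le_mul_of_nonneg_right hmean (sub_nonneg.2 hcx)]
  · have hmean := mul_sub_le_image_sub_of_le_deriv hf hm hxc
    rw [hc] at hmean
    linarith [mul_le_mul_of_nonneg_right hmean (sub_nonneg.2 hxc)]

end Calculus

section NestedCost

/-- The leader's cost along the follower's response `h`. -/
def reducedCost (JL : ℝ → ℝ → ℝ) (h : ℝ → ℝ) (x : ℝ) : ℝ :=
  JL x (h x)

/-- A nested pair of costs: `h x₁` minimises the follower's cost given `x₁`, and `x₁s` minimises the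
leader's reduced cost, with convexity moduli `m₂` and `m₁`. -/
structure IsNestedCost (JL JF : ℝ → ℝ → ℝ) (h : ℝ → ℝ) (x₁s m₁ m₂ : ℝ) : Prop where
  contDiff_leader : ContDiff ℝ 2 (fun p : ℝ × ℝ => JL p.1 p.2)
  contDiff_follower : ContDiff ℝ 2 (fun p : ℝ × ℝ => JF p.1 p.2)
  contDiff_response : ContDiff ℝ 2 h
  partialSnd_response : ∀ x, partialSnd JF x (h x) = 0
  le_partialSnd_partialSnd : ∀ x y, m₂ ≤ partialSnd (partialSnd JF) x y
  deriv_reducedCost_eq_zero : deriv (reducedCost JL h) x₁s = 0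
  le_deriv_deriv_reducedCost : ∀ x, m₁ ≤ deriv (deriv (reducedCost JL h)) x
  pos_leader : 0 < m₁
  pos_follower : 0 < m₂

/-- A common bound `M` at `(x₁, x₂)` for the derivatives of a nested pair of costs which enter the
averaging estimates. -/
structure IsNestedBound (JL JF : ℝ → ℝ → ℝ) (h : ℝ → ℝ) (M x₁ x₂ : ℝ) : Prop where
  abs_deriv_response_le : |deriv h x₁| ≤ M
  abs_deriv_reducedCost_le : |deriv (reducedCost JL h) x₁| ≤ M
  abs_deriv_deriv_reducedCost_le : |deriv (deriv (reducedCost JL h)) x₁| ≤ M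
  abs_partialFst_le : |partialFst JF x₁ x₂| ≤ M
  abs_partialSnd_le : |partialSnd JF x₁ x₂| ≤ M
  abs_partialFst_partialSnd_le : |partialFst (partialSnd JF) x₁ x₂| ≤ M
  abs_partialSnd_partialSnd_le : |partialSnd (partialSnd JF) x₁ x₂| ≤ M
  abs_sub_reducedCost_le : |JL x₁ x₂ - reducedCost JL h x₁| ≤ M * |x₂ - h x₁|

/-- The points within `R` of the graph of the response `h`, over the interval of radius `R` about
`c`. -/
def responseTube (h : ℝ → ℝ) (c R : ℝ) : Set (ℝ × ℝ) :=
  {p | |p.1 - c| ≤ R ∧ |p.2 - h p.1| ≤ R}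

variable {JL JF : ℝ → ℝ → ℝ} {h : ℝ → ℝ} {x₁s m₁ m₂ : ℝ}

theorem isCompact_responseTube (hh : Continuous h) (c R : ℝ) : IsCompact (responseTube h c R) := by
  have himage : responseTube h c R =
      (fun q : ℝ × ℝ => (q.1, h q.1 + q.2)) ''
        (Metric.closedBall c R ×ˢ Metric.closedBall 0 R) := by
    ext ⟨a, b⟩
    simp only [responseTube, mem_ofPred_eq, mem_image, mem_prod, Metric.mem_closedBall,
      Real.dist_eq, sub_zero, Prod.exists, Prod.mk.injEq]
    exact ⟨fun hab => ⟨a, b - h a, hab, rfl, add_sub_cancel _ _⟩, by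
      rintro ⟨a, e, hae, rfl, rfl⟩
      rwa [add_sub_cancel_left]⟩
  rw [himage]
  exact ((isCompact_closedBall c R).prod (isCompact_closedBall 0 R)).image (by fun_prop)

namespace IsNestedCost

theorem of_contDiff_three (hJL : ContDiff ℝ 2 (fun p : ℝ × ℝ => JL p.1 p.2))
    (hJF : ContDiff ℝ 3 (fun p : ℝ × ℝ => JF p.1 p.2)) (hh : ContDiff ℝ 1 h)
    (hroot : ∀ x, deriv (JF x) (h x) = 0) (hm₂ : 0 < m₂)
    (hconvF : ∀ x y, m₂ ≤ iteratedDeriv 2 (JF x) y)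
    (hcrit : deriv (fun x => JL x (h x)) x₁s = 0) (hm₁ : 0 < m₁)
    (hconvL : ∀ x, m₁ ≤ iteratedDeriv 2 (fun x => JL x (h x)) x) :
    IsNestedCost JL JF h x₁s m₁ m₂ := by
  simp only [iteratedDeriv_succ, iteratedDeriv_zero] at hconvF hconvL
  have hslope : ContDiff ℝ (1 + 1) (fun p : ℝ × ℝ => partialSnd JF p.1 p.2) :=
    contDiff_partialSnd (n := 2) (by exact_mod_cast hJF)
  exact {
    contDiff_leader := hJL
    contDiff_follower := hJF.of_le (by norm_num)
    contDiff_response := contDiff_succ_of_implicit hslope (hh.differentiable (by simp)) hh hroot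
      fun x => (hm₂.trans_le (hconvF x (h x))).ne'
    partialSnd_response := hroot
    le_partialSnd_partialSnd := hconvF
    deriv_reducedCost_eq_zero := hcrit
    le_deriv_deriv_reducedCost := hconvL
    pos_leader := hm₁
    pos_follower := hm₂ }

variable (hN : IsNestedCost JL JF h x₁s m₁ m₂)
include hN

theorem contDiff_reducedCost : ContDiff ℝ 2 (reducedCost JL h) :=
  hN.contDiff_leader.comp (contDiff_id.prodMk hN.contDiff_response)

theorem contDiff_deriv_reducedCost : ContDiff ℝ 1 (deriv (reducedCost JL h)) :=
  (contDiff_succ_iff_deriv.1 hN.contDiff_reducedCost).2.2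

theorem contDiff_partialSnd_follower : ContDiff ℝ 1 (fun p : ℝ × ℝ => partialSnd JF p.1 p.2) :=
  contDiff_partialSnd (n := 1) hN.contDiff_follower

theorem mul_sq_le_leader (x₁ : ℝ) :
    m₁ * (x₁ - x₁s) ^ 2 ≤ (x₁ - x₁s) * deriv (reducedCost JL h) x₁ :=
  mul_sub_sq_le_of_le_deriv (hN.contDiff_deriv_reducedCost.differentiable (by simp))
    hN.le_deriv_deriv_reducedCost hN.deriv_reducedCost_eq_zero x₁

theorem mul_sq_le_follower (x₁ x₂ : ℝ) :
    m₂ * (x₂ - h x₁) ^ 2 ≤ (x₂ - h x₁) * partialSnd JF x₁ x₂ :=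
  mul_sub_sq_le_of_le_deriv
    ((hN.contDiff_partialSnd_follower.comp (contDiff_prodMk_right x₁)).differentiable (by simp))
    (hN.le_partialSnd_partialSnd x₁) (hN.partialSnd_response x₁) x₂

theorem exists_forall_isNestedBound {R : ℝ} (hR : 0 ≤ R) :
    ∃ M, ∀ p ∈ responseTube h x₁s R, IsNestedBound JL JF h M p.1 p.2 := by
  have hcompact : IsCompact (responseTube h x₁s R) :=
    isCompact_responseTube hN.contDiff_response.continuous x₁s R
  have hcont : Continuous fun p : ℝ × ℝ => (deriv h p.1, deriv (reducedCost JL h) p.1,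
      deriv (deriv (reducedCost JL h)) p.1, partialFst JF p.1 p.2, partialSnd JF p.1 p.2,
      partialFst (partialSnd JF) p.1 p.2, partialSnd (partialSnd JF) p.1 p.2) :=
    ((hN.contDiff_response.continuous_deriv (by simp)).comp continuous_fst).prodMk <|
      (hN.contDiff_deriv_reducedCost.continuous.comp continuous_fst).prodMk <|
      ((hN.contDiff_deriv_reducedCost.continuous_deriv le_rfl).comp continuous_fst).prodMk <|
      (contDiff_partialFst (n := 1) hN.contDiff_follower).continuous.prodMk <|
      hN.contDiff_partialSnd_follower.continuous.prodMk <|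
      (contDiff_partialFst (n := 0) hN.contDiff_partialSnd_follower).continuous.prodMk
      (contDiff_partialSnd (n := 0) hN.contDiff_partialSnd_follower).continuous
  obtain ⟨C, hC⟩ := hcompact.exists_bound_of_continuousOn hcont.continuousOn
  obtain ⟨K, hK⟩ := ((hN.contDiff_leader.of_le one_le_two).locallyLipschitz.locallyLipschitzOn
    (s := responseTube h x₁s R)).exists_lipschitzOnWith_of_compact hcompact
  refine ⟨max C K, fun p hp => ?_⟩
  have hbound := (hC p hp).trans (le_max_left C K)
  simp only [Prod.norm_mk, sup_le_iff, Real.norm_eq_abs] at hbound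
  obtain ⟨hh, hr, hr', hF₁, hF₂, hF₂₁, hF₂₂⟩ := hbound
  refine ⟨hh, hr, hr', hF₁, hF₂, hF₂₁, hF₂₂, ?_⟩
  have hgraph : (p.1, h p.1) ∈ responseTube h x₁s R := ⟨hp.1, by simpa using hR⟩
  calc |JL p.1 p.2 - reducedCost JL h p.1| ≤ K * dist p (p.1, h p.1) :=
        hK.dist_le_mul p hp _ hgraph
    _ = K * |p.2 - h p.1| := by simp [Prod.dist_eq, Real.dist_eq]
    _ ≤ max C K * |p.2 - h p.1| := by gcongr; exact le_max_right C K

end IsNestedCost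

end NestedCost

section Trajectory

/-- The component `√(α ω) cos (ω t + k J(x₁, x₂))` of the nested extremum-seeking vector field. -/
noncomputable def dither (α k ω : ℝ) (J : ℝ → ℝ → ℝ) (t : ℝ) (x : EuclideanSpace ℝ (Fin 2)) : ℝ :=
  √(α * ω) * Real.cos (ω * t + k * J (x 0) (x 1))

/-- The ultimate distance of the follower from its response, when `M` bounds the derivatives of the
costs: a tracking error in which the leader's dither moves both the cost and the target. -/
noncomputable def followerError (α₁ ω₁ α₂ k₂ ω₂ m₂ M : ℝ) : ℝ :=
  seekingError α₂ k₂ ω₂ m₂ M √(α₁ * ω₁) (M * √(α₁ * ω₁)) 0 0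

/-- The ultimate distance of the leader from its optimum, when the follower starts within `N` of its
response: the velocity of the leader then has an error proportional to the follower's distance from
its response. -/
noncomputable def leaderError (α₁ k₁ ω₁ α₂ k₂ ω₂ m₁ m₂ M N : ℝ) : ℝ :=
  seekingError α₁ k₁ ω₁ m₁ M 0 0 (√(α₁ * ω₁) * k₁ * M * followerError α₁ ω₁ α₂ k₂ ω₂ m₂ M)
    (√(α₁ * ω₁) * k₁ * M * (N / (α₂ * k₂ / 2 * m₂)))

variable {JL JF : ℝ → ℝ → ℝ} {h : ℝ → ℝ} {x₁s m₁ m₂ α₁ k₁ ω₁ α₂ k₂ ω₂ M N t₀ T t : ℝ}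
  {x : ℝ → EuclideanSpace ℝ (Fin 2)} {s : Set ℝ}

theorem abs_dither_le (α k ω : ℝ) (J : ℝ → ℝ → ℝ) (t : ℝ) (x : EuclideanSpace ℝ (Fin 2)) :
    |dither α k ω J t x| ≤ √(α * ω) := by
  rw [dither, abs_mul, abs_of_nonneg (Real.sqrt_nonneg _)]
  exact mul_le_of_le_one_right (Real.sqrt_nonneg _) (Real.abs_cos_le_one _)

section Coordinates

variable (hx : IsIntegralCurveOn x (nesField JL JF α₁ k₁ ω₁ α₂ k₂ ω₂) s)
include hx

theorem hasDerivWithinAt_leader (ht : t ∈ s) :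
    HasDerivWithinAt (fun t => x t 0) (dither α₁ k₁ ω₁ JL t (x t)) s t :=
  (hasFDerivWithinAt_euclidean.1 (hx t ht).hasFDerivWithinAt 0).hasDerivWithinAt.congr_deriv
    (one_smul ℝ _)

theorem hasDerivWithinAt_follower (ht : t ∈ s) :
    HasDerivWithinAt (fun t => x t 1) (dither α₂ k₂ ω₂ JF t (x t)) s t :=
  (hasFDerivWithinAt_euclidean.1 (hx t ht).hasFDerivWithinAt 1).hasDerivWithinAt.congr_deriv
    (one_smul ℝ _)

end Coordinates

theorem IsNestedBound.abs_dither_sub_le {x : EuclideanSpace ℝ (Fin 2)} (hk₁ : 0 ≤ k₁)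
    (hM : IsNestedBound JL JF h M (x 0) (x 1)) :
    |dither α₁ k₁ ω₁ JL t x -
        √(α₁ * ω₁) * Real.cos (ω₁ * t + k₁ * reducedCost JL h (x 0))| ≤
      √(α₁ * ω₁) * k₁ * M * |x 1 - h (x 0)| := by
  have hcos := Real.abs_cos_sub_cos_le (ω₁ * t + k₁ * JL (x 0) (x 1))
    (ω₁ * t + k₁ * reducedCost JL h (x 0))
  rw [add_sub_add_left_eq_sub, ← mul_sub, abs_mul, abs_of_nonneg hk₁] at hcos
  calc _ = √(α₁ * ω₁) * |Real.cos (ω₁ * t + k₁ * JL (x 0) (x 1)) -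
          Real.cos (ω₁ * t + k₁ * reducedCost JL h (x 0))| := by
        rw [dither, ← mul_sub, abs_mul, abs_of_nonneg (Real.sqrt_nonneg _)]
    _ ≤ √(α₁ * ω₁) * (k₁ * (M * |x 1 - h (x 0)|)) := by
        gcongr
        exact hcos.trans (mul_le_mul_of_nonneg_left hM.abs_sub_reducedCost_le hk₁)
    _ = √(α₁ * ω₁) * k₁ * M * |x 1 - h (x 0)| := by ring

namespace IsNestedCost

variable (hN : IsNestedCost JL JF h x₁s m₁ m₂)
include hN

theorem hasDerivWithinAt_response
    (hx : IsIntegralCurveOn x (nesField JL JF α₁ k₁ ω₁ α₂ k₂ ω₂) s) (ht : t ∈ s) :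
    HasDerivWithinAt (fun t => h (x t 0)) (deriv h (x t 0) * dither α₁ k₁ ω₁ JL t (x t)) s t :=
  (hN.contDiff_response.differentiable (by simp) (x t 0)).hasDerivAt.comp_hasDerivWithinAt t
    (hasDerivWithinAt_leader hx ht)

theorem isSeekingLoop_follower
    (hx : IsIntegralCurveOn x (nesField JL JF α₁ k₁ ω₁ α₂ k₂ ω₂) s)
    (hM : ∀ t ∈ s, IsNestedBound JL JF h M (x t 0) (x t 1)) :
    IsSeekingLoop α₂ k₂ ω₂ M √(α₁ * ω₁) (fun t => x t 1) (fun t => JF (x t 0) (x t 1))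
      (fun t => partialSnd JF (x t 0) (x t 1)) (fun t => dither α₂ k₂ ω₂ JF t (x t))
      (fun t => partialFst JF (x t 0) (x t 1) * dither α₁ k₁ ω₁ JL t (x t))
      (fun t => partialFst (partialSnd JF) (x t 0) (x t 1) * dither α₁ k₁ ω₁ JL t (x t) +
        partialSnd (partialSnd JF) (x t 0) (x t 1) * dither α₂ k₂ ω₂ JF t (x t)) 0 s where
  hasDerivWithinAt_state t ht := hasDerivWithinAt_follower hx ht
  hasDerivWithinAt_cost t ht :=
    (hasDerivWithinAt_comp_prodMk (hN.contDiff_follower.differentiable (by simp))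
      (hasDerivWithinAt_leader hx ht) (hasDerivWithinAt_follower hx ht)).congr_deriv (add_comm _ _)
  hasDerivWithinAt_slope t ht :=
    hasDerivWithinAt_comp_prodMk (hN.contDiff_partialSnd_follower.differentiable (by simp))
      (hasDerivWithinAt_leader hx ht) (hasDerivWithinAt_follower hx ht)
  velocity_eq t _ := (add_zero _).symm
  abs_velocity_le t _ := abs_dither_le _ _ _ _ _ _
  abs_slope_le t ht := (hM t ht).abs_partialSnd_le
  abs_displacement_le t ht := by
    rw [abs_mul]
    gcongr
    · exact (abs_nonneg _).trans (hM t ht).abs_partialFst_le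
    exacts [(hM t ht).abs_partialFst_le, abs_dither_le _ _ _ _ _ _]
  abs_slope_velocity_le t ht := by
    have hM₀ : 0 ≤ M := (abs_nonneg _).trans (hM t ht).abs_partialFst_le
    refine (abs_add_le _ _).trans ?_
    rw [abs_mul, abs_mul, mul_add]
    gcongr
    exacts [(hM t ht).abs_partialFst_partialSnd_le, abs_dither_le _ _ _ _ _ _,
      (hM t ht).abs_partialSnd_partialSnd_le, abs_dither_le _ _ _ _ _ _]

theorem isSeekingLoop_leader
    (hx : IsIntegralCurveOn x (nesField JL JF α₁ k₁ ω₁ α₂ k₂ ω₂) s)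
    (hM : ∀ t ∈ s, IsNestedBound JL JF h M (x t 0) (x t 1)) :
    IsSeekingLoop α₁ k₁ ω₁ M 0 (fun t => x t 0) (fun t => reducedCost JL h (x t 0))
      (fun t => deriv (reducedCost JL h) (x t 0)) (fun t => dither α₁ k₁ ω₁ JL t (x t)) 0
      (fun t => deriv (deriv (reducedCost JL h)) (x t 0) * dither α₁ k₁ ω₁ JL t (x t))
      (fun t => dither α₁ k₁ ω₁ JL t (x t) -
        √(α₁ * ω₁) * Real.cos (ω₁ * t + k₁ * reducedCost JL h (x t 0))) s where
  hasDerivWithinAt_state t ht := hasDerivWithinAt_leader hx ht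
  hasDerivWithinAt_cost t ht := by
    have hcost : HasDerivAt (reducedCost JL h) _ (x t 0) :=
      (hN.contDiff_reducedCost.differentiable (by simp) _).hasDerivAt
    exact (hcost.comp_hasDerivWithinAt t (hasDerivWithinAt_leader hx ht)).congr_deriv
      (add_zero _).symm
  hasDerivWithinAt_slope t ht := by
    have hslope : HasDerivAt (deriv (reducedCost JL h)) _ (x t 0) :=
      (hN.contDiff_deriv_reducedCost.differentiable (by simp) _).hasDerivAt
    exact hslope.comp_hasDerivWithinAt t (hasDerivWithinAt_leader hx ht)
  velocity_eq t _ := (add_sub_cancel _ _).symm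
  abs_velocity_le t _ := abs_dither_le _ _ _ _ _ _
  abs_slope_le t ht := (hM t ht).abs_deriv_reducedCost_le
  abs_displacement_le t _ := by simp
  abs_slope_velocity_le t ht := by
    rw [abs_mul, zero_add]
    gcongr
    · exact (abs_nonneg _).trans (hM t ht).abs_partialFst_le
    exacts [(hM t ht).abs_deriv_deriv_reducedCost_le, abs_dither_le _ _ _ _ _ _]

section Parameters

variable (hα₁ : 0 < α₁) (hk₁ : 0 < k₁) (hω₁ : 0 < ω₁) (hα₂ : 0 < α₂) (hk₂ : 0 < k₂) (hω₂ : 0 < ω₂)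
include hα₂ hk₂ hω₂

theorem abs_follower_sub_response_le
    (hx : IsIntegralCurveOn x (nesField JL JF α₁ k₁ ω₁ α₂ k₂ ω₂) (Icc t₀ T))
    (hM : ∀ t ∈ Icc t₀ T, IsNestedBound JL JF h M (x t 0) (x t 1)) (ht : t ∈ Icc t₀ T) :
    |x t 1 - h (x t 0)| ≤
      |x t₀ 1 - h (x t₀ 0)| * Real.exp (-(α₂ * k₂ / 2 * m₂ * (t - t₀))) +
        followerError α₁ ω₁ α₂ k₂ ω₂ m₂ M := by
  have hM₀ : 0 ≤ M := (abs_nonneg _).trans (hM t ht).abs_partialFst_le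
  refine (hN.isSeekingLoop_follower hx hM).abs_state_sub_target_le hα₂ hk₂ hω₂ hN.pos_follower
    (Real.sqrt_nonneg _) (by positivity) le_rfl le_rfl le_rfl
    (fun s hs => hN.hasDerivWithinAt_response hx hs) (fun s hs => ?_) (fun s _ => by simp)
    (fun s _ => hN.mul_sq_le_follower _ _) ht
  rw [abs_mul]
  gcongr
  exacts [(hM s hs).abs_deriv_response_le, abs_dither_le _ _ _ _ _ _]

include hα₁ hk₁ hω₁

theorem abs_leader_sub_optimum_le
    (hx : IsIntegralCurveOn x (nesField JL JF α₁ k₁ ω₁ α₂ k₂ ω₂) (Icc t₀ T))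
    (hM : ∀ t ∈ Icc t₀ T, IsNestedBound JL JF h M (x t 0) (x t 1))
    (hx₀ : |x t₀ 1 - h (x t₀ 0)| ≤ N) (ht : t ∈ Icc t₀ T) :
    |x t 0 - x₁s| ≤ |x t₀ 0 - x₁s| * Real.exp (-(α₁ * k₁ / 2 * m₁ * (t - t₀))) +
      leaderError α₁ k₁ ω₁ α₂ k₂ ω₂ m₁ m₂ M N := by
  have hM₀ : 0 ≤ M := (abs_nonneg _).trans (hM t ht).abs_partialFst_le
  have hN₀ : 0 ≤ N := (abs_nonneg _).trans hx₀
  have hm₂ := hN.pos_follower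
  have hν : 0 < α₂ * k₂ / 2 * m₂ := by positivity
  have hfollower : 0 ≤ followerError α₁ ω₁ α₂ k₂ ω₂ m₂ M :=
    seekingError_nonneg hα₂.le hk₂.le hω₂.le hN.pos_follower.le hM₀ (Real.sqrt_nonneg _)
      (by positivity) le_rfl le_rfl
  refine (hN.isSeekingLoop_leader hx hM).abs_state_sub_target_le (c := fun _ => x₁s) (w := 0) hα₁
    hk₁ hω₁ hN.pos_leader le_rfl le_rfl (by positivity) (by positivity) hν.le
    (fun s _ => hasDerivWithinAt_const _ _ _) (fun s _ => by simp) (fun s hs => ?_)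
    (fun s _ => hN.mul_sq_le_leader _) ht
  calc _ ≤ √(α₁ * ω₁) * k₁ * M * |x s 1 - h (x s 0)| := (hM s hs).abs_dither_sub_le hk₁.le
    _ ≤ √(α₁ * ω₁) * k₁ * M * (N * Real.exp (-(α₂ * k₂ / 2 * m₂ * (s - t₀))) +
          followerError α₁ ω₁ α₂ k₂ ω₂ m₂ M) := by
        gcongr
        exact (hN.abs_follower_sub_response_le hα₂ hk₂ hω₂ hx hM hs).trans (by gcongr)
    _ = _ := by
        field_simp
        ring

theorem mem_responseTube_of_error_lt_one
    (hM : ∀ p ∈ responseTube h x₁s (N + 1), IsNestedBound JL JF h M p.1 p.2)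
    (hfollower : followerError α₁ ω₁ α₂ k₂ ω₂ m₂ M < 1)
    (hleader : leaderError α₁ k₁ ω₁ α₂ k₂ ω₂ m₁ m₂ M N < 1)
    (hx : IsIntegralCurveOn x (nesField JL JF α₁ k₁ ω₁ α₂ k₂ ω₂) (Ici t₀))
    (hx₀ : (x t₀ 0, x t₀ 1) ∈ responseTube h x₁s N) (ht : t₀ ≤ t) :
    (x t 0, x t 1) ∈ responseTube h x₁s (N + 1) := by
  have hμ : 0 < α₁ * k₁ / 2 * m₁ := mul_pos (by positivity) hN.pos_leader
  have hν : 0 < α₂ * k₂ / 2 * m₂ := mul_pos (by positivity) hN.pos_follower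
  have hcont : ContinuousOn (fun t => max |x t 0 - x₁s| |x t 1 - h (x t 0)|) (Ici t₀) :=
    fun s hs =>
    (((hasDerivWithinAt_leader hx hs).sub_const x₁s).continuousWithinAt.abs).max
      ((hasDerivWithinAt_follower hx hs).sub
        (hN.hasDerivWithinAt_response hx hs)).continuousWithinAt.abs
  refine max_le_iff.1 (forall_le_of_forall_le_imp_lt hcont
    ((max_le hx₀.1 hx₀.2).trans (by linarith)) (fun s hs hbound => ?_) ht)
  have hxs := hx.mono (Icc_subset_Ici_self : Icc t₀ s ⊆ Ici t₀)
  have hMs : ∀ τ ∈ Icc t₀ s, IsNestedBound JL JF h M (x τ 0) (x τ 1) := fun τ hτ =>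
    hM (x τ 0, x τ 1) (max_le_iff.1 (hbound τ hτ))
  have hs' : s ∈ Icc t₀ s := right_mem_Icc.2 hs
  refine max_lt ?_ ?_
  · linarith [hN.abs_leader_sub_optimum_le hα₁ hk₁ hω₁ hα₂ hk₂ hω₂ hxs hMs hx₀.2 hs',
      mul_le_of_le_one_right (abs_nonneg (x t₀ 0 - x₁s)) (exp_neg_mul_sub_le_one hμ.le hs), hx₀.1]
  · linarith [hN.abs_follower_sub_response_le hα₂ hk₂ hω₂ hxs hMs hs',
      mul_le_of_le_one_right (abs_nonneg (x t₀ 1 - h (x t₀ 0)))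
        (exp_neg_mul_sub_le_one hν.le hs), hx₀.2]

end Parameters

end IsNestedCost

end Trajectory

section Tuning

theorem tendsto_sqrt_mul_div_atTop (α : ℝ) : Tendsto (fun ω => √(α * ω) / ω) atTop (𝓝 0) := by
  have hlim : Tendsto (fun ω => √α * (√ω)⁻¹) atTop (𝓝 0) := by
    simpa only [mul_zero] using!
      (tendsto_inv_atTop_zero.comp Real.tendsto_sqrt_atTop).const_mul √α
  refine hlim.congr' ?_
  filter_upwards [eventually_ge_atTop 0] with ω hω
  rw [Real.sqrt_mul' _ hω, mul_div_assoc, Real.sqrt_div_self]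

theorem tendsto_avgShift (α k M : ℝ) : Tendsto (fun ω => avgShift α k ω M) atTop (𝓝 0) := by
  have hlim := (tendsto_sqrt_mul_div_atTop α).add
    (tendsto_inv_atTop_zero.const_mul (α * k / 4 * M))
  rw [mul_zero, add_zero] at hlim
  refine hlim.congr fun ω => ?_
  unfold avgShift
  ring

theorem tendsto_avgDrift (α k M B : ℝ) :
    Tendsto (fun ω => avgDrift α k ω M B) atTop (𝓝 0) := by
  have hlim := ((tendsto_sqrt_mul_div_atTop α).const_mul
    (k * (M * B) + α * k / 4 * (2 * k * M * M + M))).add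
    (tendsto_inv_atTop_zero.const_mul (α * k / 4 * (2 * k * (M * B) * M + M * B)))
  rw [mul_zero, mul_zero, add_zero] at hlim
  refine hlim.congr fun ω => ?_
  unfold avgDrift
  ring

theorem tendsto_avgGain (α k M : ℝ) : Tendsto (fun ω => avgGain α k ω M) atTop (𝓝 1) := by
  simpa only [zero_mul, add_zero] using!
    (((tendsto_sqrt_mul_div_atTop α).mul_const k).mul_const M).const_add 1

theorem tendsto_seekingError (α k m M B V D κ : ℝ) :
    Tendsto (fun ω => seekingError α k ω m M B V D κ) atTop
      (𝓝 ((V + D) / (α * k / 2 * m) + κ)) := by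
  simpa only [zero_add, one_mul, mul_zero, add_zero] using!
    (((((tendsto_avgDrift α k M B).add_const V).add ((tendsto_avgGain α k M).mul_const D)).div_const
      (α * k / 2 * m)).add ((tendsto_avgShift α k M).const_mul 2)).add
      ((tendsto_avgGain α k M).mul_const κ)

theorem tendsto_seekingError_comp {ι : Type*} {l : Filter ι} {D κ : ι → ℝ} {D₀ κ₀ : ℝ}
    (α k ω m M B V : ℝ) (hD : Tendsto D l (𝓝 D₀)) (hκ : Tendsto κ l (𝓝 κ₀)) :
    Tendsto (fun i => seekingError α k ω m M B V (D i) (κ i)) l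
      (𝓝 (seekingError α k ω m M B V D₀ κ₀)) := by
  unfold seekingError
  exact ((((hD.const_mul _).const_add _).div_const _).add_const _).add (hκ.const_mul _)

theorem tendsto_followerError (α₁ ω₁ α₂ k₂ m₂ M : ℝ) :
    Tendsto (fun ω₂ => followerError α₁ ω₁ α₂ k₂ ω₂ m₂ M) atTop
      (𝓝 (M * √(α₁ * ω₁) / (α₂ * k₂ / 2 * m₂))) := by
  simpa only [add_zero] using! tendsto_seekingError α₂ k₂ m₂ M √(α₁ * ω₁) (M * √(α₁ * ω₁)) 0 0

theorem tendsto_relaxationRate_atTop {α m : ℝ} (hα : 0 < α) (hm : 0 < m) :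
    Tendsto (fun k => α * k / 2 * m) atTop atTop :=
  ((tendsto_id.const_mul_atTop hα).atTop_div_const two_pos).atTop_mul_const hm

theorem tendsto_leaderError (α₁ k₁ ω₁ α₂ k₂ m₁ m₂ M N : ℝ) :
    Tendsto (fun ω₂ => leaderError α₁ k₁ ω₁ α₂ k₂ ω₂ m₁ m₂ M N) atTop
      (𝓝 (seekingError α₁ k₁ ω₁ m₁ M 0 0
        (√(α₁ * ω₁) * k₁ * M * (M * √(α₁ * ω₁) / (α₂ * k₂ / 2 * m₂)))
        (√(α₁ * ω₁) * k₁ * M * (N / (α₂ * k₂ / 2 * m₂))))) := by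
  unfold leaderError
  exact tendsto_seekingError_comp α₁ k₁ ω₁ m₁ M 0 0
    ((tendsto_followerError α₁ ω₁ α₂ k₂ m₂ M).const_mul _) tendsto_const_nhds

theorem tendsto_limit_leaderError {α₂ m₂ : ℝ} (α₁ k₁ ω₁ m₁ M N : ℝ) (hα₂ : 0 < α₂)
    (hm₂ : 0 < m₂) :
    Tendsto (fun k₂ => seekingError α₁ k₁ ω₁ m₁ M 0 0
      (√(α₁ * ω₁) * k₁ * M * (M * √(α₁ * ω₁) / (α₂ * k₂ / 2 * m₂)))
      (√(α₁ * ω₁) * k₁ * M * (N / (α₂ * k₂ / 2 * m₂)))) atTop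
      (𝓝 (seekingError α₁ k₁ ω₁ m₁ M 0 0 0 0)) := by
  have hdiv (c : ℝ) :
      Tendsto (fun k₂ => √(α₁ * ω₁) * k₁ * M * (c / (α₂ * k₂ / 2 * m₂))) atTop (𝓝 0) := by
    simpa only [mul_zero] using
      ((tendsto_relaxationRate_atTop hα₂ hm₂).const_div_atTop c).const_mul (√(α₁ * ω₁) * k₁ * M)
  exact tendsto_seekingError_comp α₁ k₁ ω₁ m₁ M 0 0 (hdiv (M * √(α₁ * ω₁))) (hdiv N)

theorem eventually_error_lt {α₂ m₂ δ : ℝ} (α₁ k₁ m₁ M N : ℝ) (hα₂ : 0 < α₂) (hm₂ : 0 < m₂)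
    (hδ : 0 < δ) :
    ∀ᶠ ω₁ in atTop, ∀ᶠ k₂ in atTop, ∀ᶠ ω₂ in atTop,
      followerError α₁ ω₁ α₂ k₂ ω₂ m₂ M < δ ∧ leaderError α₁ k₁ ω₁ α₂ k₂ ω₂ m₁ m₂ M N < δ := by
  have hlimit : Tendsto (fun ω₁ => seekingError α₁ k₁ ω₁ m₁ M 0 0 0 0) atTop (𝓝 0) := by
    simpa only [add_zero, zero_div] using tendsto_seekingError α₁ k₁ m₁ M 0 0 0 0
  filter_upwards [hlimit.eventually_lt_const hδ] with ω₁ hω₁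
  have hdiv := (tendsto_relaxationRate_atTop hα₂ hm₂).const_div_atTop (M * √(α₁ * ω₁))
  filter_upwards [hdiv.eventually_lt_const hδ,
    (tendsto_limit_leaderError α₁ k₁ ω₁ m₁ M N hα₂ hm₂).eventually_lt_const hω₁]
    with k₂ hfollower hleader
  exact ((tendsto_followerError α₁ ω₁ α₂ k₂ m₂ M).eventually_lt_const hfollower).and
    ((tendsto_leaderError α₁ k₁ ω₁ α₂ k₂ m₁ m₂ M N).eventually_lt_const hleader)

end Tuning

section ComparisonFunctions

theorem isClassK_const_mul {c : ℝ} (hc : 0 < c) : IsClassK fun r => c * r where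
  continuousOn := by fun_prop
  strictMonoOn := (strictMono_mul_left_of_pos hc).strictMonoOn _
  map_zero := mul_zero c

theorem isClassKInf_id : IsClassKInf id where
  continuousOn := continuousOn_id
  strictMonoOn := strictMonoOn_id
  map_zero := rfl
  tendsto_atTop := tendsto_id

namespace IsClassK

variable {γ γ' : ℝ → ℝ} {β : ℝ → ℝ → ℝ} {a b c r : ℝ}

theorem map_le_map (hγ : IsClassK γ) (ha : 0 ≤ a) (hab : a ≤ b) : γ a ≤ γ b :=
  hγ.strictMonoOn.monotoneOn ha (ha.trans hab) hab

theorem nonneg (hγ : IsClassK γ) (hr : 0 ≤ r) : 0 ≤ γ r :=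
  hγ.map_zero ▸ hγ.map_le_map le_rfl hr

theorem add (hγ : IsClassK γ) (hγ' : IsClassK γ') : IsClassK fun r => γ r + γ' r where
  continuousOn := hγ.continuousOn.add hγ'.continuousOn
  strictMonoOn := hγ.strictMonoOn.add hγ'.strictMonoOn
  map_zero := by rw [hγ.map_zero, hγ'.map_zero, add_zero]

theorem map_add_le (hγ : IsClassK γ) (ha : 0 ≤ a) (hb : 0 ≤ b) :
    γ (a + b) ≤ γ (2 * a) + γ (2 * b) := by
  have ha' : 0 ≤ 2 * a := by positivity
  have hb' : 0 ≤ 2 * b := by positivity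
  rcases le_total a b with hab | hab
  · exact (hγ.map_le_map (add_nonneg ha hb) (by linarith)).trans
      (le_add_of_nonneg_left (hγ.nonneg ha'))
  · exact (hγ.map_le_map (add_nonneg ha hb) (by linarith)).trans
      (le_add_of_nonneg_right (hγ.nonneg hb'))

theorem tendsto_nhdsGE_zero (hγ : IsClassK γ) : Tendsto γ (𝓝[≥] 0) (𝓝 0) := by
  simpa only [ContinuousWithinAt, hγ.map_zero] using hγ.continuousOn 0 self_mem_Ici

theorem isClassKL_mul_exp (hγ : IsClassK γ) (hc : 0 < c) :
    IsClassKL fun r s => γ r * Real.exp (-(c * s)) where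
  continuousOn := (hγ.continuousOn.comp continuousOn_fst fun _ hp => hp.1).mul (by fun_prop)
  isClassK s _ :=
    { continuousOn := hγ.continuousOn.mul continuousOn_const
      strictMonoOn := fun _ ha _ hb hab =>
        mul_lt_mul_of_pos_right (hγ.strictMonoOn ha hb hab) (Real.exp_pos _)
      map_zero := by rw [hγ.map_zero, zero_mul] }
  antitoneOn r hr s _ s' _ hs := mul_le_mul_of_nonneg_left
    (Real.exp_le_exp.2 (neg_le_neg (mul_le_mul_of_nonneg_left hs hc.le))) (hγ.nonneg hr)
  tendsto_zero r _ := by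
    simpa only [mul_zero] using! (Real.tendsto_exp_neg_atTop_nhds_zero.comp
      (tendsto_id.const_mul_atTop hc)).const_mul (γ r)

theorem comp_isClassKL (hγ : IsClassK γ) (hβ : IsClassKL β) : IsClassKL fun r s => γ (β r s) where
  continuousOn := hγ.continuousOn.comp hβ.continuousOn fun p hp =>
    (hβ.isClassK p.2 hp.2).nonneg hp.1
  isClassK s hs :=
    { continuousOn := hγ.continuousOn.comp (hβ.isClassK s hs).continuousOn fun _ hr =>
        (hβ.isClassK s hs).nonneg hr
      strictMonoOn := fun _ ha _ hb hab =>
        hγ.strictMonoOn ((hβ.isClassK s hs).nonneg ha) ((hβ.isClassK s hs).nonneg hb)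
          ((hβ.isClassK s hs).strictMonoOn ha hb hab)
      map_zero := by rw [(hβ.isClassK s hs).map_zero, hγ.map_zero] }
  antitoneOn r hr _ hs _ hs' hss' :=
    hγ.map_le_map ((hβ.isClassK _ hs').nonneg hr) (hβ.antitoneOn r hr hs hs' hss')
  tendsto_zero r hr :=
    hγ.tendsto_nhdsGE_zero.comp <| tendsto_nhdsWithin_iff.2 ⟨hβ.tendsto_zero r hr,
      (eventually_ge_atTop 0).mono fun s hs => (hβ.isClassK s hs).nonneg hr⟩

end IsClassK

theorem IsClassKL.add {β β' : ℝ → ℝ → ℝ} (hβ : IsClassKL β) (hβ' : IsClassKL β') :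
    IsClassKL fun r s => β r s + β' r s where
  continuousOn := hβ.continuousOn.add hβ'.continuousOn
  isClassK s hs := (hβ.isClassK s hs).add (hβ'.isClassK s hs)
  antitoneOn r hr := (hβ.antitoneOn r hr).add (hβ'.antitoneOn r hr)
  tendsto_zero r hr := by
    simpa only [add_zero] using (hβ.tendsto_zero r hr).add (hβ'.tendsto_zero r hr)

section Modulus

variable {E F : Type*} [NormedAddCommGroup E] [NormedSpace ℝ E] [ProperSpace E]
  [SeminormedAddCommGroup F] {f : E → F}

/-- The modulus of continuity of `f` at `c`, with the identity added to make it strictly increasing.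
The ball of radius `r` is written as a dilate of the unit ball, so that the supremum is over a fixed
compact set. -/
noncomputable def classKModulus (f : E → F) (c : E) (r : ℝ) : ℝ :=
  r + sSup ((fun s => ‖f (c + r • s) - f c‖) '' Metric.closedBall 0 1)

theorem bddAbove_image_norm_sub (hf : Continuous f) (c : E) (r : ℝ) :
    BddAbove ((fun s => ‖f (c + r • s) - f c‖) '' Metric.closedBall 0 1) :=
  (isCompact_closedBall 0 1).bddAbove_image (by fun_prop)

theorem isClassK_classKModulus (hf : Continuous f) (c : E) : IsClassK (classKModulus f c) where
  continuousOn := (continuous_id.add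
    ((isCompact_closedBall 0 1).continuous_sSup (by fun_prop))).continuousOn
  strictMonoOn a ha b hb hab := by
    refine add_lt_add_of_lt_of_le hab (csSup_le_csSup (bddAbove_image_norm_sub hf c b)
      ⟨_, mem_image_of_mem _ (Metric.mem_closedBall_self zero_le_one)⟩ ?_)
    rintro _ ⟨s, hs, rfl⟩
    have hb' : 0 < b := ha.trans_lt hab
    refine ⟨(a / b) • s, ?_, by simp only [smul_smul, mul_div_cancel₀ a hb'.ne']⟩
    rw [mem_closedBall_zero_iff] at hs ⊢
    rw [norm_smul, Real.norm_of_nonneg (div_nonneg ha hb)]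
    exact mul_le_one₀ ((div_le_one hb').2 hab.le) (norm_nonneg s) hs
  map_zero := by simp [classKModulus]

theorem norm_sub_le_classKModulus (hf : Continuous f) (c u : E) :
    ‖f u - f c‖ ≤ classKModulus f c ‖u - c‖ := by
  have hu : ‖u - c‖ • (‖u - c‖⁻¹ • (u - c)) = u - c := by
    rcases eq_or_ne (u - c) 0 with h | h
    · simp [h]
    · rw [smul_inv_smul₀ (norm_ne_zero_iff.2 h)]
  refine (le_csSup (bddAbove_image_norm_sub hf c ‖u - c‖) ⟨‖u - c‖⁻¹ • (u - c), ?_, ?_⟩).trans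
    (le_add_of_nonneg_left (norm_nonneg _))
  · rw [mem_closedBall_zero_iff, norm_smul, norm_inv, norm_norm]
    exact inv_mul_le_one
  · simp only [hu, add_sub_cancel]

end Modulus

/-- The decay estimate for a nested loop with rate `c`, when `γ` is a modulus of the response: it
adds the leader's distance, the follower's distance from its response, and the displacement of the
response. -/
noncomputable def nestedDecay (γ : ℝ → ℝ) (c r s : ℝ) : ℝ :=
  (2 * r + γ r) * Real.exp (-(c * s)) + γ (2 * r * Real.exp (-(c * s)))

theorem IsClassK.isClassKL_nestedDecay {γ : ℝ → ℝ} {c : ℝ} (hγ : IsClassK γ) (hc : 0 < c) :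
    IsClassKL (nestedDecay γ c) :=
  (((isClassK_const_mul two_pos).add hγ).isClassKL_mul_exp hc).add
    (hγ.comp_isClassKL ((isClassK_const_mul two_pos).isClassKL_mul_exp hc))

end ComparisonFunctions

section Existence

section General

variable {E : Type*} [NormedAddCommGroup E] [NormedSpace ℝ E] {f : ℝ → E → E} {x y : ℝ → E} {L : ℝ}

omit [NormedSpace ℝ E] in
theorem exists_forall_lipschitzOnWith (hf : LocallyLipschitz (Function.uncurry f)) {S : Set E}
    (hS : IsCompact S) (a b : ℝ) : ∃ K, ∀ t ∈ Icc a b, LipschitzOnWith K (f t) S := by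
  obtain ⟨K, hK⟩ := (hf.locallyLipschitzOn (s := Icc a b ×ˢ S)).exists_lipschitzOnWith_of_compact
    (isCompact_Icc.prod hS)
  refine ⟨K, fun t ht => LipschitzOnWith.of_dist_le_mul fun u hu v hv => ?_⟩
  simpa only [Function.uncurry_apply_pair, dist_prod_same_left] using
    hK.dist_le_mul (t, u) ⟨ht, hu⟩ (t, v) ⟨ht, hv⟩

theorem hasDerivWithinAt_Ici_of_isIntegralCurveOn_Icc {a b t : ℝ}
    (hx : IsIntegralCurveOn x f (Icc a b)) (ht : t ∈ Ico a b) :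
    HasDerivWithinAt x (f t (x t)) (Ici t) t :=
  (hx t (Ico_subset_Icc_self ht)).mono_of_mem_nhdsWithin (Icc_mem_nhdsGE_of_mem ht)

theorem eqOn_Icc_of_isIntegralCurveOn (hf : LocallyLipschitz (Function.uncurry f)) {a b : ℝ}
    (hx : IsIntegralCurveOn x f (Icc a b)) (hy : IsIntegralCurveOn y f (Icc a b))
    (ha : x a = y a) : EqOn x y (Icc a b) := by
  obtain ⟨K, hK⟩ := exists_forall_lipschitzOnWith hf
    ((isCompact_Icc.image_of_continuousOn hx.continuousOn).union
      (isCompact_Icc.image_of_continuousOn hy.continuousOn)) a b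
  exact ODE_solution_unique_of_mem_Icc_right (s := fun _ => x '' Icc a b ∪ y '' Icc a b)
    (fun t ht => hK t (Ico_subset_Icc_self ht))
    hx.continuousOn (fun t => hasDerivWithinAt_Ici_of_isIntegralCurveOn_Icc hx)
    (fun t ht => .inl (mem_image_of_mem x (Ico_subset_Icc_self ht)))
    hy.continuousOn (fun t => hasDerivWithinAt_Ici_of_isIntegralCurveOn_Icc hy)
    (fun t ht => .inr (mem_image_of_mem y (Ico_subset_Icc_self ht))) ha

theorem exists_isIntegralCurveOn_Icc_of_norm_le [ProperSpace E]
    (hf : LocallyLipschitz (Function.uncurry f)) (hL : ∀ t x, ‖f t x‖ ≤ L) {a b : ℝ} (hab : a ≤ b)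
    (x₀ : E) : ∃ x : ℝ → E, x a = x₀ ∧ IsIntegralCurveOn x f (Icc a b) := by
  lift L to NNReal using (norm_nonneg _).trans (hL a x₀)
  lift b - a to NNReal using sub_nonneg.2 hab with T hT
  obtain ⟨K, hK⟩ := exists_forall_lipschitzOnWith hf
    (isCompact_closedBall x₀ ((L * T : NNReal) : ℝ)) a b
  have hpicard : IsPicardLindelof f ⟨a, left_mem_Icc.2 hab⟩ x₀ (L * T) 0 L K := {
    lipschitzOnWith := hK
    continuousOn x _ := (hf.continuous.comp (.prodMk_left x)).continuousOn
    norm_le t _ x _ := hL t x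
    mul_max_le := by
      rw [sub_self, max_eq_left (sub_nonneg.2 hab), ← hT, NNReal.coe_zero, sub_zero,
        NNReal.coe_mul] }
  exact hpicard.exists_eq_forall_mem_Icc_hasDerivWithinAt₀

theorem exists_isIntegralCurveOn_Ici_of_norm_le [ProperSpace E]
    (hf : LocallyLipschitz (Function.uncurry f)) (hL : ∀ t x, ‖f t x‖ ≤ L) (t₀ : ℝ) (x₀ : E) :
    ∃ x : ℝ → E, x t₀ = x₀ ∧ IsIntegralCurveOn x f (Ici t₀) := by
  choose! x hx₀ hx using fun T hT =>
    exists_isIntegralCurveOn_Icc_of_norm_le hf hL (a := t₀) (b := T) hT x₀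
  have hglue : ∀ {T}, t₀ ≤ T → EqOn (fun t => x t t) (x T) (Icc t₀ T) := fun {T} hT t ht =>
    eqOn_Icc_of_isIntegralCurveOn hf (hx t ht.1) ((hx T hT).mono (Icc_subset_Icc_right ht.2))
      ((hx₀ t ht.1).trans (hx₀ T hT).symm) (right_mem_Icc.2 ht.1)
  refine ⟨fun t => x t t, hx₀ t₀ le_rfl, fun t (ht : t₀ ≤ t) => ?_⟩
  have hT : t₀ ≤ t + 1 := by linarith
  have htT : t ∈ Icc t₀ (t + 1) := ⟨ht, by linarith⟩
  have hderiv := (hx (t + 1) hT t htT).congr (hglue hT) (hglue hT htT)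
  rw [← hglue hT htT] at hderiv
  exact hderiv.mono_of_mem_nhdsWithin
    (inter_mem_nhdsWithin (Ici t₀) (Iic_mem_nhds (lt_add_one t)))

end General

theorem norm_le_abs_add_abs (y : EuclideanSpace ℝ (Fin 2)) : ‖y‖ ≤ |y 0| + |y 1| := by
  rw [EuclideanSpace.norm_eq, Fin.sum_univ_two, Real.norm_eq_abs, Real.norm_eq_abs]
  exact Real.sqrt_le_iff.2 ⟨by positivity,
    by linarith [add_sq |y 0| |y 1|, mul_nonneg (abs_nonneg (y 0)) (abs_nonneg (y 1))]⟩

theorem contDiff_dither {n : WithTop ℕ∞} {J : ℝ → ℝ → ℝ}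
    (hJ : ContDiff ℝ n (fun p : ℝ × ℝ => J p.1 p.2)) (α k ω : ℝ) :
    ContDiff ℝ n fun p : ℝ × EuclideanSpace ℝ (Fin 2) => dither α k ω J p.1 p.2 := by
  have : ContDiff ℝ n fun p : ℝ × EuclideanSpace ℝ (Fin 2) => J (p.2 0) (p.2 1) :=
    hJ.comp (f := fun p : ℝ × EuclideanSpace ℝ (Fin 2) => (p.2 0, p.2 1)) (by fun_prop)
  unfold dither
  fun_prop

theorem exists_isIntegralCurveOn_nesField {JL JF : ℝ → ℝ → ℝ}
    (hJL : ContDiff ℝ 1 (fun p : ℝ × ℝ => JL p.1 p.2))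
    (hJF : ContDiff ℝ 1 (fun p : ℝ × ℝ => JF p.1 p.2)) (α₁ k₁ ω₁ α₂ k₂ ω₂ t₀ : ℝ)
    (x₀ : EuclideanSpace ℝ (Fin 2)) :
    ∃ x, x t₀ = x₀ ∧ IsIntegralCurveOn x (nesField JL JF α₁ k₁ ω₁ α₂ k₂ ω₂) (Ici t₀) := by
  have hsmooth : ContDiff ℝ 1 (Function.uncurry (nesField JL JF α₁ k₁ ω₁ α₂ k₂ ω₂)) := by
    refine contDiff_euclidean.2 fun i => ?_
    fin_cases i
    exacts [contDiff_dither hJL α₁ k₁ ω₁, contDiff_dither hJF α₂ k₂ ω₂]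
  exact exists_isIntegralCurveOn_Ici_of_norm_le hsmooth.locallyLipschitz
    (fun t x => (norm_le_abs_add_abs _).trans
      (add_le_add (abs_dither_le α₁ k₁ ω₁ JL t x) (abs_dither_le α₂ k₂ ω₂ JF t x))) t₀ x₀

end Existence

section Stability

variable {JL JF : ℝ → ℝ → ℝ} {h γ : ℝ → ℝ} {c x₁s m₁ m₂ α₁ k₁ ω₁ α₂ k₂ ω₂ M R δ t₀ t : ℝ}
  {p : EuclideanSpace ℝ (Fin 2)} {x : ℝ → EuclideanSpace ℝ (Fin 2)}

theorem norm_sub_le_of_modulus (hh : ∀ u, |h u - h c| ≤ γ |u - c|) :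
    ‖p - !₂[c, h c]‖ ≤ |p 0 - c| + |p 1 - h (p 0)| + γ |p 0 - c| :=
  calc ‖p - !₂[c, h c]‖ ≤ |p 0 - c| + |p 1 - h c| := norm_le_abs_add_abs (p - !₂[c, h c])
    _ ≤ |p 0 - c| + (|p 1 - h (p 0)| + γ |p 0 - c|) := by
      gcongr
      exact (abs_sub_le _ (h (p 0)) _).trans (by gcongr; exact hh _)
    _ = _ := (add_assoc _ _ _).symm

theorem abs_sub_response_le_of_modulus (hγ : IsClassK γ) (hh : ∀ u, |h u - h c| ≤ γ |u - c|) :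
    |p 1 - h (p 0)| ≤ ‖p - !₂[c, h c]‖ + γ ‖p - !₂[c, h c]‖ := by
  have hfst : |p 0 - c| ≤ ‖p - !₂[c, h c]‖ := PiLp.norm_apply_le (p - !₂[c, h c]) 0
  have hsnd : |p 1 - h c| ≤ ‖p - !₂[c, h c]‖ := PiLp.norm_apply_le (p - !₂[c, h c]) 1
  have hresponse : |h (p 0) - h c| ≤ γ ‖p - !₂[c, h c]‖ :=
    (hh _).trans (hγ.map_le_map (abs_nonneg _) hfst)
  rw [abs_sub_comm] at hresponse
  linarith [abs_sub_le (p 1) (h c) (h (p 0))]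

namespace IsNestedCost

variable (hN : IsNestedCost JL JF h x₁s m₁ m₂) (hγ : IsClassK γ)
  (hh : ∀ u, |h u - h x₁s| ≤ γ |u - x₁s|)
include hN hγ hh

theorem norm_sub_le_nestedDecay_add (hα₁ : 0 < α₁) (hk₁ : 0 < k₁) (hω₁ : 0 < ω₁) (hα₂ : 0 < α₂)
    (hk₂ : 0 < k₂) (hω₂ : 0 < ω₂) (hδ : 0 ≤ δ) (hδ₁ : δ ≤ 1)
    (hrate : α₁ * k₁ / 2 * m₁ ≤ α₂ * k₂ / 2 * m₂)
    (hM : ∀ p ∈ responseTube h x₁s (R + γ R + 1), IsNestedBound JL JF h M p.1 p.2)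
    (hfollower : followerError α₁ ω₁ α₂ k₂ ω₂ m₂ M < δ)
    (hleader : leaderError α₁ k₁ ω₁ α₂ k₂ ω₂ m₁ m₂ M (R + γ R) < δ)
    (hx₀ : ‖x t₀ - !₂[x₁s, h x₁s]‖ ≤ R)
    (hx : IsIntegralCurveOn x (nesField JL JF α₁ k₁ ω₁ α₂ k₂ ω₂) (Ici t₀)) (ht : t₀ ≤ t) :
    ‖x t - !₂[x₁s, h x₁s]‖ ≤
      nestedDecay γ (α₁ * k₁ / 2 * m₁) ‖x t₀ - !₂[x₁s, h x₁s]‖ (t - t₀) +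
        (2 * δ + γ (2 * δ)) := by
  have hfst₀ : |x t₀ 0 - x₁s| ≤ ‖x t₀ - !₂[x₁s, h x₁s]‖ :=
    PiLp.norm_apply_le (x t₀ - !₂[x₁s, h x₁s]) 0
  have hsnd₀ := abs_sub_response_le_of_modulus (p := x t₀) hγ hh
  set r := ‖x t₀ - !₂[x₁s, h x₁s]‖
  have hr : 0 ≤ r := norm_nonneg _
  have hγr : γ r ≤ γ R := hγ.map_le_map hr hx₀
  have hγr₀ : 0 ≤ γ r := hγ.nonneg hr
  have hstart : |x t₀ 1 - h (x t₀ 0)| ≤ R + γ R := by linarith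
  have hbound : ∀ s ∈ Icc t₀ t, IsNestedBound JL JF h M (x s 0) (x s 1) := fun s hs =>
    hM (x s 0, x s 1) <| hN.mem_responseTube_of_error_lt_one hα₁ hk₁ hω₁ hα₂ hk₂ hω₂ hM
      (hfollower.trans_le hδ₁) (hleader.trans_le hδ₁) hx
      ⟨show |x t₀ 0 - x₁s| ≤ R + γ R by linarith, hstart⟩ hs.1
  have hxt : IsIntegralCurveOn x _ (Icc t₀ t) := hx.mono Icc_subset_Ici_self
  have ht' : t ∈ Icc t₀ t := right_mem_Icc.2 ht
  set e := Real.exp (-(α₁ * k₁ / 2 * m₁ * (t - t₀)))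
  have hfst : |x t 0 - x₁s| ≤ r * e + δ :=
    (hN.abs_leader_sub_optimum_le hα₁ hk₁ hω₁ hα₂ hk₂ hω₂ hxt hbound hstart ht').trans (by gcongr)
  have hsnd : |x t 1 - h (x t 0)| ≤ (r + γ r) * e + δ := by
    refine (hN.abs_follower_sub_response_le hα₂ hk₂ hω₂ hxt hbound ht').trans ?_
    have hexp : Real.exp (-(α₂ * k₂ / 2 * m₂ * (t - t₀))) ≤ e :=
      Real.exp_le_exp.2 (neg_le_neg (mul_le_mul_of_nonneg_right hrate (sub_nonneg.2 ht)))
    gcongr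
  have hresponse : γ |x t 0 - x₁s| ≤ γ (2 * (r * e)) + γ (2 * δ) :=
    (hγ.map_le_map (abs_nonneg _) hfst).trans
      (hγ.map_add_le (by positivity) hδ)
  calc _ ≤ _ := norm_sub_le_of_modulus hh
    _ ≤ r * e + δ + ((r + γ r) * e + δ) + (γ (2 * (r * e)) + γ (2 * δ)) := by gcongr
    _ = _ := by rw [nestedDecay, ← mul_assoc 2 r e]; ring

theorem eventually_norm_sub_le_nestedDecay_add (hα₁ : 0 < α₁) (hk₁ : 0 < k₁) (hα₂ : 0 < α₂)
    (hR : 0 ≤ R) {υ : ℝ} (hυ : 0 < υ) :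
    ∀ᶠ ω₁ in atTop, ∀ᶠ k₂ in atTop, ∀ᶠ ω₂ in atTop,
      ∀ (t₀ : ℝ) (x : ℝ → EuclideanSpace ℝ (Fin 2)), ‖x t₀ - !₂[x₁s, h x₁s]‖ ≤ R →
        IsIntegralCurveOn x (nesField JL JF α₁ k₁ ω₁ α₂ k₂ ω₂) (Ici t₀) → ∀ t, t₀ ≤ t →
        ‖x t - !₂[x₁s, h x₁s]‖ ≤
          nestedDecay γ (α₁ * k₁ / 2 * m₁) ‖x t₀ - !₂[x₁s, h x₁s]‖ (t - t₀) + υ := by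
  obtain ⟨δ, hδυ, hδ₀, hδ₁⟩ : ∃ δ, 2 * δ + γ (2 * δ) < υ ∧ 0 < δ ∧ δ < 1 := by
    have hclassK : IsClassK fun δ => δ + γ δ := by
      simpa only [one_mul] using (isClassK_const_mul one_pos).add hγ
    obtain ⟨η, hηυ, hη₀, hη₁⟩ := (((hclassK.tendsto_nhdsGE_zero.mono_left
      (nhdsWithin_mono _ Ioi_subset_Ici_self)).eventually_lt_const hυ).and
      (Ioo_mem_nhdsGT (zero_lt_two (α := ℝ)))).exists
    exact ⟨η / 2, by rwa [mul_div_cancel₀ η two_ne_zero], half_pos hη₀, by linarith⟩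
  obtain ⟨M, hM⟩ := hN.exists_forall_isNestedBound (R := R + γ R + 1)
    (by linarith [hγ.nonneg hR])
  filter_upwards [eventually_error_lt α₁ k₁ m₁ M (R + γ R) hα₂ hN.pos_follower hδ₀,
    eventually_gt_atTop 0] with ω₁ herror hω₁
  filter_upwards [herror, eventually_gt_atTop 0,
    (tendsto_relaxationRate_atTop hα₂ hN.pos_follower).eventually_ge_atTop (α₁ * k₁ / 2 * m₁)]
    with k₂ herror hk₂ hrate
  filter_upwards [herror, eventually_gt_atTop 0] with ω₂ herror hω₂ t₀ x hx₀ hx t ht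
  exact (hN.norm_sub_le_nestedDecay_add hγ hh hα₁ hk₁ hω₁ hα₂ hk₂ hω₂ hδ₀.le hδ₁.le hrate hM
    herror.1 herror.2 hx₀ hx ht).trans (by gcongr)

end IsNestedCost

theorem exists_threshold_of_eventually (P : ℝ → Prop) :
    ∃ A, 0 < A ∧ ((∀ᶠ a in atTop, P a) → ∀ a, A < a → P a) := by
  by_cases hP : ∀ᶠ a in atTop, P a
  · obtain ⟨A, hA, hPA⟩ := (atTop_basis_Ioi' 0).eventually_iff.1 hP
    exact ⟨A + 1, by positivity, fun _ a ha => hPA ((lt_add_one A).trans ha)⟩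
  · exact ⟨1, one_pos, fun h => absurd h hP⟩

theorem exists_thresholds_of_eventually {P : ℝ → ℝ → ℝ → ℝ → Prop}
    (hP : ∀ υ, 0 < υ → ∀ᶠ a in atTop, ∀ᶠ b in atTop, ∀ᶠ c in atTop, P υ a b c) :
    ∃ (A : ℝ → ℝ) (B : ℝ → ℝ → ℝ) (C : ℝ → ℝ → ℝ → ℝ),
      (∀ υ, 0 < A υ) ∧ (∀ υ a, 0 < B υ a) ∧ (∀ υ a b, 0 < C υ a b) ∧
      ∀ υ, 0 < υ → ∀ a, A υ < a → ∀ b, B υ a < b → ∀ c, C υ a b < c → P υ a b c := by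
  choose A hA₀ hA using exists_threshold_of_eventually
  exact ⟨fun υ => A fun a => ∀ᶠ b in atTop, ∀ᶠ c in atTop, P υ a b c,
    fun υ a => A fun b => ∀ᶠ c in atTop, P υ a b c, fun υ a b => A (P υ a b),
    fun _ => hA₀ _, fun _ _ => hA₀ _, fun _ _ _ => hA₀ _,
    fun υ hυ a ha b hb c hc => hA _ (hA _ (hA _ (hP υ hυ) a ha) b hb) c hc⟩

end Stability

theorem theorem3
    (JL JF : ℝ → ℝ → ℝ) (h : ℝ → ℝ) (x₁s m₁ m₂ : ℝ)
    -- smoothness of the costs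
    (hJL : ContDiff ℝ 2 (fun p : ℝ × ℝ => JL p.1 p.2))
    (hJF : ContDiff ℝ 3 (fun p : ℝ × ℝ => JF p.1 p.2))
    -- `h x₁` is the unique root of `∂₂ J_F(x₁, ·)`, and `h` is `C¹`
    (hroot : ∀ x₁ x₂ : ℝ, deriv (JF x₁) x₂ = 0 ↔ x₂ = h x₁)
    (hh : ContDiff ℝ 1 h)
    -- strong convexity of the follower's cost
    (hm₂ : 0 < m₂) (hconvF : ∀ x₁ x₂ : ℝ, m₂ ≤ iteratedDeriv 2 (JF x₁) x₂)
    -- stationarity at `x₁s` and strong convexity of the leader's reduced cost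
    (hcrit : deriv (fun x₁ => JL x₁ (h x₁)) x₁s = 0)
    (hm₁ : 0 < m₁) (hconvL : ∀ x₁ : ℝ, m₁ ≤ iteratedDeriv 2 (fun x => JL x (h x)) x₁)
    -- fixed design parameters
    (α₁ k₁ α₂ : ℝ) (hα₁ : 0 < α₁) (hk₁ : 0 < k₁) (hα₂ : 0 < α₂) :
    ∃ (ω₁s : ℝ → ℝ) (εs : ℝ → ℝ → ℝ) (ω₂s : ℝ → ℝ → ℝ → ℝ),
      (∀ υ, 0 < ω₁s υ) ∧ (∀ υ ω₁, 0 < εs υ ω₁) ∧ (∀ υ ω₁ ε, 0 < ω₂s υ ω₁ ε) ∧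
      IsSPUAS
        (fun υ => {f | ∃ ω₁ k₂ ω₂ ε : ℝ, 0 < k₂ ∧ ε = 1 / (α₂ * k₂) ∧
          ω₁s υ < ω₁ ∧ ε < εs υ ω₁ ∧ ω₂s υ ω₁ ε < ω₂ ∧
          f = nesField JL JF α₁ k₁ ω₁ α₂ k₂ ω₂})
        !₂[x₁s, h x₁s] := by
  have hN := IsNestedCost.of_contDiff_three hJL hJF hh (fun x => (hroot x _).2 rfl) hm₂ hconvF
    hcrit hm₁ hconvL
  have hγ := isClassK_classKModulus hh.continuous x₁s
  obtain ⟨A, B, C, hA, hB, hC, hABC⟩ := exists_thresholds_of_eventually fun υ hυ =>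
    hN.eventually_norm_sub_le_nestedDecay_add hγ (norm_sub_le_classKModulus hh.continuous x₁s)
      hα₁ hk₁ hα₂ (one_div_pos.2 hυ).le hυ
  refine ⟨A, fun υ ω₁ => 1 / (α₂ * B υ ω₁), fun υ ω₁ ε => C υ ω₁ (1 / (α₂ * ε)), hA,
    fun υ ω₁ => one_div_pos.2 (mul_pos hα₂ (hB υ ω₁)), fun υ ω₁ ε => hC _ _ _, _, id,
    hγ.isClassKL_nestedDecay (c := α₁ * k₁ / 2 * m₁) (by positivity), isClassKInf_id,
    fun K hK => ?_⟩
  obtain ⟨R, hR₀, hR⟩ := hK.isBounded.subset_closedBall_lt 0 !₂[x₁s, h x₁s]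
  refine ⟨1 / R, one_div_pos.2 hR₀, ?_⟩
  rintro υ hυ hυR _ ⟨ω₁, k₂, ω₂, ε, hk₂, rfl, hω₁, hε, hω₂, rfl⟩ t₀ x₀ hx₀
  refine ⟨exists_isIntegralCurveOn_nesField (hJL.of_le one_le_two) (hJF.of_le (by norm_num))
    _ _ _ _ _ _ t₀ x₀, ?_⟩
  rintro x rfl hx
  have hk₂B : B υ ω₁ < k₂ := lt_of_mul_lt_mul_left
    ((one_div_lt_one_div (mul_pos hα₂ hk₂) (mul_pos hα₂ (hB υ ω₁))).1 hε) hα₂.le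
  have hk₂ε : 1 / (α₂ * (1 / (α₂ * k₂))) = k₂ := by field_simp
  have hRυ : R ≤ 1 / υ := ((lt_one_div hυ hR₀).1 hυR).le
  exact hABC υ hυ ω₁ hω₁ k₂ hk₂B ω₂ (hk₂ε ▸ hω₂) t₀ x
    ((mem_closedBall_iff_norm.1 (hR hx₀)).trans hRυ) hx
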